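/- **Setting.** Let $d\ge 1$, let $\psi_1,\dots,\psi_n:\mathbb R^d\to\mathbb R^d$ be contracting diffeomorphisms of class $C^{1,\nu_0}$ ($0<\nu_0\le 1$), and let $G=\bigcup_i\psi_i(G)$ be the associated nonempty compact set. For a word $w=x_0\dots x_{l-1}$ put $[w]_G=\psi_{x_0}\circ\dots\circ\psi_{x_{l-1}}(G)$, and for $x\in\Sigma=\{1,\dots,n\}^{\mathbb N}$ let $\Phi(x)$ be the unique point of $\bigcap_l[x_0\dots x_l]_G$. Assume: * $\psi_i(G)\cap\psi_j(G)$ is finite for $i\ne j$; put $\mathcal F=\bigcup_{i\neq j}\psi_i(G)\cap\psi_j(G)$; * $G$ is post-critically finite: $\bigcup_{j\ge1}\sigma^j(\Phi^{-1}(\mathcal F))$ is finite, where $\sigma$ is the left shift on $\Sigma$; * there are disjoint open sets $\mathcal O_1,\dots,\mathcal O_n$ with $G\cap\mathcal O_i=\psi_i(G)\setminus\bigcup_{j\ne i}(\psi_i(G)\cap\psi_j(G))$; * (nondegeneracy) there is $b>0$ such that for all $x\in G$ and $v,v_0\in\mathbb R^d$ some $i$ satisfies $|(D\psi_i(x)v,v_0)|\ge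 b\|v\|\,\|v_0\|$; * the Jacobian matrices $D\psi_i(x)=D_i$ do not depend on $x\in\mathbb R^d$. Let $M^d$ be the space of symmetric real $d\times d$ matrices, $(A,B)_{HS}=\mathrm{tr}({}^tAB)$, and let $(\mathcal L_GA)(x)=\sum_i{}^tD\psi_i(x)A(\psi_i(x))D\psi_i(x)$ for $A\in C(G,M^d)$. Call $(\beta,Q_G,\tau_G)$ a *Gibbs triple* if $\beta>0$; $Q_G\in C(G,M^d)$ is positive definite at every point and $\mathcal L_GQ_G=\beta Q_G$; $\tau_G$ is a Borel measure on $G$ with values in the positive semidefinite symmetric matrices such that $\int_G(\mathcal L_GA,d\tau_G)_{HS}=\beta\int_G(A,d\tau_G)_{HS}$ for all $A\in C(G,M^d)$; and $\int_G(Q_G,d\tau_G)_{HS}=1$. Let $(Q_G,\tau_G)_{HS}$ be the scalar measure $B\mapsto\int_B(Q_G,d\tau_G)_{HS}$. A finite positive Borel measure $\kappa$ on $G$ is a *Kusuoka measure* if there are $\beta>0$ and nonzero positive semidefinite $Q,\hat Q\in M^d$ with $\beta Q=\sum_i{}^tD_iQD_i$ and $\beta\hat Q=\sum_iD_i\hat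 Q\,{}^tD_i$ such that, for every nonempty word $w=x_0\dots x_{l-1}$, with $D_w=D_{x_0}\cdots D_{x_{l-1}}$, $$\kappa([w]_G)=\beta^{-l}\,\bigl(Q,\;D_w\,\hat Q\,{}^tD_w\bigr)_{HS}.$$ **Theorem.** Gibbs triples exist, and Kusuoka measures exist. For every Gibbs triple $(\beta,Q_G,\tau_G)$: 1. $Q_G$ is a constant matrix, and $\beta Q_G=\sum_i{}^tD_iQ_GD_i$; 2. $\beta\,\tau_G(G)=\sum_iD_i\,\tau_G(G)\,{}^tD_i$; 3. for every Kusuoka measure $\kappa$ there is a constant $c>0$ with $(Q_G,\tau_G)_{HS}=c\,\kappa$ on all Borel subsets of $G$. -/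

import Mathlib

open MeasureTheory Set
open scoped Matrix NNReal ENNReal

attribute [local instance] Matrix.frobeniusNormedAddCommGroup Matrix.frobeniusNormedSpace

namespace Fractal

/-- The Euclidean space `ℝ^d`. -/
abbrev Euc (d : ℕ) : Type := EuclideanSpace ℝ (Fin d)

/-- Real `d × d` matrices, normed by the Hilbert-Schmidt (Frobenius) norm. -/
abbrev Mat (d : ℕ) : Type := Matrix (Fin d) (Fin d) ℝ

/-- Borel vector measures with values in a normed space `F`. -/
abbrev NormedMeasure (X : Type*) [MeasurableSpace X] (F : Type*) [NormedAddCommGroup F] : Type _ :=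
  VectorMeasure X F

/-- Continuous real bilinear forms on a normed space `F`. -/
abbrev NormedPairing (F : Type*) [NormedAddCommGroup F] [NormedSpace ℝ F] : Type _ :=
  F →L[ℝ] F →L[ℝ] ℝ

/-- The Jacobian matrix of `f` at `x`: its `(k, l)` entry is the derivative of the `k`-th component
of `f` in the direction of the `l`-th coordinate vector. -/
noncomputable def jac {d : ℕ} (f : Euc d → Euc d) (x : Euc d) : Mat d :=
  Matrix.of fun k l => (fderiv ℝ f x (EuclideanSpace.single l 1)) k

/-- The Hilbert-Schmidt product `(A, B)_HS = tr (ᵗA B)`, as a continuous bilinear form. -/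
noncomputable def hs (d : ℕ) : NormedPairing (Mat d) :=
  (LinearMap.mk₂ ℝ (fun A B : Mat d => (Aᵀ * B).trace)
    (fun A A' B => by simp [Matrix.add_mul])
    (fun c A B => by simp)
    (fun A B B' => by simp [Matrix.mul_add])
    (fun c A B => by simp)).toContinuousBilinearMap

@[simp] theorem hs_apply {d : ℕ} (A B : Mat d) : hs d A B = (Aᵀ * B).trace := rfl

/-- Finitely many contracting `C^{1,ν₀}` diffeomorphisms of `ℝ^d`, together with their attractor:
the (unique) nonempty compact set `G` with `G = ⋃ i, ψ i (G)`. -/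
structure IFS (d n : ℕ) where
  /-- the maps -/
  ψ : Fin n → Euc d → Euc d
  /-- the attractor -/
  G : Set (Euc d)
  contDiff : ∀ i, ContDiff ℝ 1 (ψ i)
  holder : ∃ ν₀ : ℝ≥0, 0 < ν₀ ∧ ν₀ ≤ 1 ∧ ∀ i, ∃ C : ℝ≥0, HolderWith C ν₀ (fderiv ℝ (ψ i))
  diffeo : ∀ i, ∃ g : Euc d → Euc d,
    ContDiff ℝ 1 g ∧ Function.LeftInverse g (ψ i) ∧ Function.RightInverse g (ψ i)
  contracting : ∃ η : ℝ≥0, η < 1 ∧ ∀ i, LipschitzWith η (ψ i)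
  isCompact : IsCompact G
  nonempty : G.Nonempty
  selfSimilar : G = ⋃ i, ψ i '' G

namespace IFS

variable {d n : ℕ} (S : IFS d n)

theorem mapsTo (i : Fin n) {x : Euc d} (hx : x ∈ S.G) : S.ψ i x ∈ S.G := by
  rw [S.selfSimilar]
  exact mem_iUnion.2 ⟨i, x, hx, rfl⟩

/-- The map `ψ i`, as a map of the attractor into itself. -/
def branch (i : Fin n) (x : S.G) : S.G := ⟨S.ψ i x, S.mapsTo i x.2⟩

/-- The composition `ψ_{w₀} ∘ ⋯ ∘ ψ_{w_{l-1}}` along a word `w`. -/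
def wordMap : List (Fin n) → Euc d → Euc d
  | [] => id
  | i :: w => S.ψ i ∘ wordMap w

/-- The cell `[w₀ … w_{l-1}]_G = ψ_{w₀} ∘ ⋯ ∘ ψ_{w_{l-1}} (G)` of the fractal. -/
def cell (w : List (Fin n)) : Set (Euc d) := S.wordMap w '' S.G

/-- The set `⋃_{i ≠ j} ψ i (G) ∩ ψ j (G)`. -/
def overlap : Set (Euc d) := ⋃ (i) (j) (_ : i ≠ j), S.ψ i '' S.G ∩ S.ψ j '' S.G

/-- The sequence `x` codes the point `y`, that is `Φ(x) = y`. As the cells `[x₀ … x_l]_G` are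
decreasing, compact, nonempty and their diameters tend to zero, their intersection is one point
`Φ(x)`. -/
def Codes (x : ℕ → Fin n) (y : Euc d) : Prop :=
  ∀ l : ℕ, y ∈ S.cell (List.ofFn fun k : Fin (l + 1) => x k)

/-- The set `Φ⁻¹(⋃_{i ≠ j} ψ i (G) ∩ ψ j (G))` of codings of the overlap points. -/
def overlapCodings : Set (ℕ → Fin n) := {x | ∃ y ∈ S.overlap, S.Codes x y}

/-- Distinct first-level cells intersect in finitely many points. -/
def FiniteOverlap : Prop := ∀ i j, i ≠ j → (S.ψ i '' S.G ∩ S.ψ j '' S.G).Finite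

/-- The fractal is post-critically finite: `⋃_{j ≥ 1} σ^j(Φ⁻¹(overlap))` is finite, where
`σ` is the left shift. -/
def PostCriticallyFinite : Prop :=
  (⋃ j : ℕ, (fun (x : ℕ → Fin n) (k : ℕ) => x (k + (j + 1))) '' S.overlapCodings).Finite

/-- The first-level cells, without the overlaps, are cut out of `G` by disjoint open sets. -/
def OpenSeparation : Prop :=
  ∃ O : Fin n → Set (Euc d), (∀ i, IsOpen (O i)) ∧ (Pairwise fun i j => Disjoint (O i) (O j)) ∧
    ∀ i, S.G ∩ O i = (S.ψ i '' S.G) \ ⋃ (j) (_ : j ≠ i), S.ψ i '' S.G ∩ S.ψ j '' S.G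

/-- Nondegeneracy of the derivatives: there is `b > 0` such that for all `v, v₀ ∈ ℝ^d` and
`x ∈ G` there is `i` with `|(Dψ_i(x) v, v₀)| ≥ b ‖v‖ ‖v₀‖`. -/
def Nondegenerate : Prop :=
  ∃ b : ℝ, 0 < b ∧ ∀ x ∈ S.G, ∀ v v₀ : Euc d, ∃ i,
    b * ‖v‖ * ‖v₀‖ ≤ |inner ℝ (fderiv ℝ (S.ψ i) x v) v₀|

/-- The Ruelle operator `(L A)(x) = ∑ i, ᵗDψ_i(x) A(ψ_i(x)) Dψ_i(x)`. -/
noncomputable def ruelle (A : S.G → Mat d) (x : S.G) : Mat d :=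
  ∑ i, (jac (S.ψ i) x)ᵀ * A (S.branch i x) * jac (S.ψ i) x

/-- `Q` is a continuous, positive-definite eigenfunction of the Ruelle operator `L` with eigenvalue
`β > 0`, and `τ` is a Borel measure on `G`, with values in the positive semidefinite symmetric
matrices, which satisfies `L* τ = β τ` in the dual of the space of continuous functions with
symmetric values, and is normalised by `∫ (Q, dτ)_HS = 1`. -/
structure IsGibbs (β : ℝ) (Q : S.G → Mat d) (τ : NormedMeasure S.G (Mat d)) : Prop where
  pos : 0 < β
  continuous : Continuous Q
  posDef : ∀ x, (Q x).PosDef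
  eigen : ∀ x, S.ruelle Q x = β • Q x
  posSemidef : ∀ B, MeasurableSet B → (τ B).PosSemidef
  dual_eigen : ∀ A : S.G → Mat d, Continuous A → (∀ x, (A x).IsSymm) →
    τ.integral (S.ruelle A) (hs d) = β * τ.integral A (hs d)
  normalised : τ.integral Q (hs d) = 1

/-- The scalar measure `(Q, τ)_HS : B ↦ ∫_B (Q, dτ)_HS`. -/
noncomputable def hsMeasure (Q : S.G → Mat d) (τ : NormedMeasure S.G (Mat d)) :
    SignedMeasure S.G :=
  τ.withDensity Q (hs d)

/-- `κ` is a Kusuoka measure for the constant derivatives `D i`: for a `β > 0` and nonzero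
positive semidefinite `Q`, `Q'` with `β Q = ∑ i, ᵗD_i Q D_i` and `β Q' = ∑ i, D_i Q' ᵗD_i`, the mass
of every cell is `κ([w₀ … w_{l-1}]_G) = β^{-l} (Q, D_w Q' ᵗD_w)_HS`, where
`D_w = D_{w₀} ⋯ D_{w_{l-1}}`. -/
structure IsKusuoka (D : Fin n → Mat d) (κ : Measure S.G) : Prop where
  finite : IsFiniteMeasure κ
  cells : ∃ (β : ℝ) (Q Q' : Mat d), 0 < β ∧ Q.PosSemidef ∧ Q ≠ 0 ∧ Q'.PosSemidef ∧ Q' ≠ 0 ∧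
    β • Q = ∑ i, (D i)ᵀ * Q * D i ∧
    β • Q' = ∑ i, D i * Q' * (D i)ᵀ ∧
    ∀ w : List (Fin n), w ≠ [] →
      κ.real (Subtype.val ⁻¹' S.cell w) =
        (β ^ w.length)⁻¹ * hs d Q ((w.map D).prod * Q' * ((w.map D).prod)ᵀ)

end IFS

end Fractal

/-! Since the derivatives are constant, the Ruelle operator on constant functions is the map L M = ∑
ᵗD_i M D_i, which preserves the cone of positive semidefinite matrices. Nondegeneracy says that for
nonzero v, w some (D_i v, w) is nonzero; hence L sends every nonzero semidefinite matrix to a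
positive definite one (`Irred.posDef_transfer`). This gives Perron-Frobenius theory for L and, by
transposition, for its dual: positive eigenvectors exist, semidefinite ones are unique up to a
factor, and pairing an eigenvector of L with one of the dual shows that both eigenvalues agree.

The maps contract, so the iterates of β⁻¹L on continuous functions become constant
(`eventually_oscLE`). A positive eigenfunction is fixed by β⁻¹L and hence constant. For existence,
let T be an eigenvector of the dual: the functionals A ↦ ((β⁻¹L)^l A(x), T) have a limit along an
ultrafilter, and this limit is a matrix measure τ of total mass T with β τ = ∑ D_i (ψ_i)_*τ ᵗD_i
(`exists_isSelfSimilar`). The dual eigenvalue equation of a Gibbs triple is equivalent to this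
self-similarity.

To compute τ on cells, overlaps must be null. With at least two maps, each D_i strictly contracts
the form Q after division by β, because another branch takes a fixed share of βQ; since
post-criticality makes the codings of a finite set finite in number, finite sets are null.
Self-similarity then yields Kusuoka's formula on cells. A Kusuoka measure has the same cell masses
up to one constant, by uniqueness of the eigenvectors, and its exponentially small cells exclude
atoms. Finite measures with null overlaps are determined by their cells (`measure_eq_of_subcell`),
so the two are proportional. -/

namespace Fractal

/-! ### Quadratic forms and the Hilbert-Schmidt pairing. -/

variable {d n : ℕ}

/-- The quadratic form `v ↦ (M v, v)` of a matrix. -/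
noncomputable def quad (M : Mat d) (v : Fin d → ℝ) : ℝ := v ⬝ᵥ M *ᵥ v

theorem quad_add (M N : Mat d) (v : Fin d → ℝ) : quad (M + N) v = quad M v + quad N v := by
  simp [quad, Matrix.add_mulVec]

theorem quad_sub (M N : Mat d) (v : Fin d → ℝ) : quad (M - N) v = quad M v - quad N v := by
  simp [quad, Matrix.sub_mulVec]

theorem quad_smul (c : ℝ) (M : Mat d) (v : Fin d → ℝ) : quad (c • M) v = c * quad M v := by
  simp [quad, Matrix.smul_mulVec]

theorem quad_sum {ι : Type*} (s : Finset ι) (M : ι → Mat d) (v : Fin d → ℝ) :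
    quad (∑ i ∈ s, M i) v = ∑ i ∈ s, quad (M i) v := by
  simp [quad, Matrix.sum_mulVec, dotProduct_sum]

theorem quad_smul_right (M : Mat d) (c : ℝ) (v : Fin d → ℝ) :
    quad M (c • v) = c ^ 2 * quad M v := by
  simp [quad, Matrix.mulVec_smul]; ring

theorem quad_conj (M C : Mat d) (v : Fin d → ℝ) : quad (Cᵀ * M * C) v = quad M (C *ᵥ v) := by
  simp only [quad, ← Matrix.mulVec_mulVec, Matrix.dotProduct_mulVec, Matrix.vecMul_transpose]

theorem continuous_quad : Continuous fun p : Mat d × (Fin d → ℝ) => quad p.1 p.2 := by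
  unfold quad
  fun_prop

theorem posSemidef_iff_quad {M : Mat d} : M.PosSemidef ↔ M.IsSymm ∧ ∀ v, 0 ≤ quad M v := by
  simp [Matrix.posSemidef_iff_dotProduct_mulVec, quad, Matrix.IsHermitian, Matrix.IsSymm]

theorem posDef_iff_quad {M : Mat d} : M.PosDef ↔ M.IsSymm ∧ ∀ v, v ≠ 0 → 0 < quad M v := by
  simp [Matrix.posDef_iff_dotProduct_mulVec, quad, Matrix.IsHermitian, Matrix.IsSymm]

theorem quad_polarization {M : Mat d} (hM : M.IsSymm) (i j : Fin d) :
    4 * M i j = quad M (Pi.single i 1 + Pi.single j 1) - quad M (Pi.single i 1 - Pi.single j 1) := by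
  have := hM.apply i j
  simp [quad, Matrix.mulVec_add, Matrix.mulVec_sub]
  linarith

theorem eq_of_quad_eq {M N : Mat d} (hM : M.IsSymm) (hN : N.IsSymm)
    (h : ∀ v, quad M v = quad N v) : M = N := by
  ext i j
  have h1 := quad_polarization hM i j
  have h2 := quad_polarization hN i j
  simp only [h] at h1
  linarith

theorem isSymm_conj {M : Mat d} (hM : M.IsSymm) (C : Mat d) : (Cᵀ * M * C).IsSymm := by
  simp [Matrix.IsSymm, Matrix.transpose_mul, hM.eq, Matrix.mul_assoc]

theorem isSymm_conj' {M : Mat d} (hM : M.IsSymm) (C : Mat d) : (C * M * Cᵀ).IsSymm := by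
  simp [Matrix.IsSymm, Matrix.transpose_mul, hM.eq, Matrix.mul_assoc]

theorem posSemidef_conj' {M : Mat d} (hM : M.PosSemidef) (C : Mat d) :
    (C * M * Cᵀ).PosSemidef := by
  simpa using hM.mul_mul_conjTranspose_same C

theorem isSymm_sum {ι : Type*} (s : Finset ι) {M : ι → Mat d} (h : ∀ i ∈ s, (M i).IsSymm) :
    (∑ i ∈ s, M i).IsSymm := by
  rw [Matrix.IsSymm, Matrix.transpose_sum]
  exact Finset.sum_congr rfl h

theorem hs_comm (A B : Mat d) : hs d A B = hs d B A := by
  rw [hs_apply, hs_apply, ← Matrix.trace_transpose, Matrix.transpose_mul, Matrix.transpose_transpose]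

theorem hs_conj (C M T : Mat d) : hs d (Cᵀ * M * C) T = hs d M (C * T * Cᵀ) := by
  simp only [hs_apply, Matrix.transpose_mul, Matrix.transpose_transpose]
  rw [Matrix.mul_assoc, Matrix.trace_mul_comm]
  simp only [Matrix.mul_assoc]

theorem hs_vecMulVec (v : Fin d → ℝ) (T : Mat d) : hs d (Matrix.vecMulVec v v) T = quad T v := by
  rw [hs_apply, Matrix.transpose_vecMulVec, Matrix.vecMulVec_mul, Matrix.trace_vecMulVec, quad,
    Matrix.dotProduct_mulVec, dotProduct_comm]

/-- Write T = ᵗB B and take the rows of B. Order relations between quadratic forms thereby become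
inequalities between pairings with T. -/
theorem exists_hs_eq_sum_quad {T : Mat d} (hT : T.PosSemidef) :
    ∃ u : Fin d → Fin d → ℝ, ∀ M, hs d M T = ∑ k, quad M (u k) := by
  obtain ⟨B, rfl⟩ : ∃ B : Mat d, T = Bᴴ * B := by
    open scoped MatrixOrder in
    exact CStarAlgebra.nonneg_iff_eq_star_mul_self.mp hT.nonneg
  refine ⟨fun k => B k, fun M => ?_⟩
  rw [hs_comm, hs_apply, Matrix.conjTranspose_eq_transpose_of_trivial, Matrix.transpose_mul,
    Matrix.transpose_transpose, Matrix.mul_assoc, Matrix.trace_mul_comm]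
  simp [Matrix.trace, quad, Matrix.mul_apply, Matrix.mulVec, dotProduct, Finset.mul_sum,
    Finset.sum_mul]
  refine Finset.sum_congr rfl fun k _ => Finset.sum_comm.trans ?_
  refine Finset.sum_congr rfl fun i _ => Finset.sum_congr rfl fun j _ => by ring

theorem hs_mono {M N T : Mat d} (hT : T.PosSemidef) (h : ∀ v, quad M v ≤ quad N v) :
    hs d M T ≤ hs d N T := by
  obtain ⟨u, hu⟩ := exists_hs_eq_sum_quad hT
  rw [hu, hu]
  exact Finset.sum_le_sum fun k _ => h _

theorem hs_nonneg {M T : Mat d} (hM : ∀ v, 0 ≤ quad M v) (hT : T.PosSemidef) : 0 ≤ hs d M T := by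
  simpa using hs_mono (M := 0) hT (by simpa [quad] using hM)

theorem hs_pos {Q T : Mat d} (hQ : Q.PosDef) (hT : T.PosSemidef) (h0 : T ≠ 0) :
    0 < hs d Q T := by
  obtain ⟨u, hu⟩ := exists_hs_eq_sum_quad hT
  have hQ' := (posDef_iff_quad.1 hQ).2
  have hQ'' := (posSemidef_iff_quad.1 hQ.posSemidef).2
  rw [hu]
  refine Finset.sum_pos' (fun k _ => hQ'' _) ?_
  by_contra! hk
  have hz : ∀ k, u k = 0 := fun k => by
    by_contra hne
    exact absurd (hk k (Finset.mem_univ _)) (not_le.2 (hQ' _ hne))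
  have := hu T
  simp only [hz, quad, zero_dotProduct, Finset.sum_const_zero, hs_apply] at this
  exact h0 (Matrix.trace_conjTranspose_mul_self_eq_zero_iff.1 (by simpa using this))

/-- The quotient of the two forms is homogeneous of degree zero, so its minimum over the compact
unit sphere is global. -/
theorem exists_quad_ratio_min (hd : 0 < d) {P : Mat d} (hP : P.PosDef) (R : Mat d) :
    ∃ (a : ℝ) (v : Fin d → ℝ), v ≠ 0 ∧ quad R v = a * quad P v ∧
      ∀ w, a * quad P w ≤ quad R w := by
  have hP' := (posDef_iff_quad.1 hP).2
  have hn0 : ∀ v : Fin d → ℝ, v ∈ Metric.sphere (0 : Fin d → ℝ) 1 → v ≠ 0 := by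
    rintro v hv rfl
    simp at hv
  have hne : (Metric.sphere (0 : Fin d → ℝ) 1).Nonempty := by
    have : Nonempty (Fin d) := ⟨⟨0, hd⟩⟩
    exact NormedSpace.sphere_nonempty.2 zero_le_one
  have hcont : ∀ M : Mat d, Continuous (quad M) := fun M =>
    continuous_quad.comp (by fun_prop : Continuous fun v : Fin d → ℝ => (M, v))
  obtain ⟨v, hv, hmin⟩ := (isCompact_sphere (0 : Fin d → ℝ) 1).exists_isMinOn hne
    (f := fun v => quad R v / quad P v)
    ((hcont R).continuousOn.div (hcont P).continuousOn fun v hv => (hP' v (hn0 v hv)).ne')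
  have hPv := hP' v (hn0 v hv)
  refine ⟨quad R v / quad P v, v, hn0 v hv, by field_simp, fun w => ?_⟩
  rcases eq_or_ne w 0 with rfl | hw
  · simp [quad]
  have hnw : 0 < ‖w‖ := norm_pos_iff.2 hw
  have hw1 : ‖w‖⁻¹ • w ∈ Metric.sphere (0 : Fin d → ℝ) 1 := by
    simp [norm_smul, hnw.ne']
  have := hmin hw1
  simp only [mem_ofPred_eq, quad_smul_right] at this
  rw [mul_div_mul_left _ _ (by positivity), le_div_iff₀ (hP' w hw)] at this
  exact this

theorem exists_smul_quad_le (hd : 0 < d) {P : Mat d} (hP : P.PosDef) (R : Mat d) :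
    ∃ ε : ℝ, 0 < ε ∧ ∀ v, ε * quad R v ≤ quad P v := by
  -- The least ratio b of -R to P gives R ≤ -b P ≤ |b| P; adding 1 keeps the inverse defined.
  obtain ⟨b, -, -, -, hb⟩ := exists_quad_ratio_min hd hP (-R)
  have hP' := (posSemidef_iff_quad.1 hP.posSemidef).2
  refine ⟨(|b| + 1)⁻¹, by positivity, fun v => ?_⟩
  have h1 := hb v
  rw [show quad (-R) v = - quad R v by simp [quad, Matrix.neg_mulVec]] at h1
  rw [inv_mul_le_iff₀ (by positivity)]
  nlinarith [hP' v, neg_abs_le b]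

/-! ### Perron-Frobenius theory on the cone of semidefinite matrices. -/

/-- The operator `M ↦ ∑ i, ᵗD_i M D_i`. -/
noncomputable def transfer (D : Fin n → Mat d) (M : Mat d) : Mat d := ∑ i, (D i)ᵀ * M * D i

/-- No two nonzero vectors are separated by all the matrices of the family. -/
def Irred (D : Fin n → Mat d) : Prop :=
  ∀ v w : Fin d → ℝ, v ≠ 0 → w ≠ 0 → ∃ i, w ⬝ᵥ D i *ᵥ v ≠ 0

theorem Irred.transpose {D : Fin n → Mat d} (h : Irred D) : Irred fun i => (D i)ᵀ := by
  intro v w hv hw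
  obtain ⟨i, hi⟩ := h w v hw hv
  refine ⟨i, ?_⟩
  rwa [Matrix.dotProduct_mulVec, Matrix.vecMul_transpose, dotProduct_comm]

theorem quad_transfer (D : Fin n → Mat d) (M : Mat d) (v : Fin d → ℝ) :
    quad (transfer D M) v = ∑ i, quad M (D i *ᵥ v) := by
  simp only [transfer, quad_sum, quad_conj]

theorem transfer_isSymm (D : Fin n → Mat d) {M : Mat d} (h : M.IsSymm) : (transfer D M).IsSymm :=
  isSymm_sum _ fun _ _ => isSymm_conj h _

theorem transfer_sub (D : Fin n → Mat d) (M N : Mat d) :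
    transfer D (M - N) = transfer D M - transfer D N := by
  simp [transfer, Matrix.mul_sub, Matrix.sub_mul]

theorem transfer_smul (D : Fin n → Mat d) (c : ℝ) (M : Mat d) :
    transfer D (c • M) = c • transfer D M := by
  simp [transfer, Finset.smul_sum]

theorem hs_transfer (D : Fin n → Mat d) (M T : Mat d) :
    hs d (transfer D M) T = hs d M (transfer (fun i => (D i)ᵀ) T) := by
  simp only [transfer, map_sum, FunLike.coe_sum, Finset.sum_apply, hs_conj,
    Matrix.transpose_transpose]

/-- If the form of the image vanishes at v ≠ 0, every D_i v lies in the kernel of M. Choose u with M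
u ≠ 0: irreducibility gives i with (M u, D_i v) ≠ 0, yet this equals (u, M D_i v) = 0. -/
theorem Irred.posDef_transfer {D : Fin n → Mat d} (h : Irred D) {M : Mat d} (hM : M.PosSemidef)
    (h0 : M ≠ 0) : (transfer D M).PosDef := by
  have hM' := posSemidef_iff_quad.1 hM
  refine posDef_iff_quad.2 ⟨transfer_isSymm D hM'.1, fun v hv => ?_⟩
  rw [quad_transfer]
  refine Finset.sum_pos' (fun i _ => hM'.2 _) ?_
  by_contra! hneg
  obtain ⟨u, hu⟩ : ∃ u, M *ᵥ u ≠ 0 := by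
    by_contra! hall
    exact h0 (eq_of_quad_eq hM'.1 Matrix.isSymm_zero fun v => by simp [quad, hall])
  obtain ⟨i, hi⟩ := h v (M *ᵥ u) hv hu
  have hz : M *ᵥ (D i *ᵥ v) = 0 := by
    rw [← hM.dotProduct_mulVec_zero_iff]
    exact le_antisymm (hneg i (Finset.mem_univ _)) (hM'.2 _)
  apply hi
  rw [dotProduct_comm, Matrix.dotProduct_mulVec, ← Matrix.mulVec_transpose, hM'.1.eq, hz,
    zero_dotProduct]

theorem isCompact_posSemidef_trace_one : IsCompact {M : Mat d | M.PosSemidef ∧ M.trace = 1} := by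
  have hK : IsCompact (Set.pi univ fun _ : Fin d => Set.pi univ fun _ : Fin d =>
      Icc (-1 : ℝ) 1) := isCompact_univ_pi fun _ => isCompact_univ_pi fun _ => isCompact_Icc
  have h1 : IsClosed (⋂ i, ⋂ j, {M : Mat d | M j i = M i j}) :=
    isClosed_iInter fun i => isClosed_iInter fun j =>
      isClosed_eq (continuous_id.matrix_elem j i) (continuous_id.matrix_elem i j)
  have h2 : IsClosed (⋂ v, {M : Mat d | 0 ≤ quad M v}) :=
    isClosed_iInter fun v => isClosed_le continuous_const
      (continuous_quad.comp (by fun_prop : Continuous fun M : Mat d => (M, v)))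
  have h3 : IsClosed {M : Mat d | M.trace = 1} :=
    isClosed_eq continuous_id.matrix_trace continuous_const
  have h4 : IsClosed {M : Mat d | M.PosSemidef ∧ M.trace = 1} := by
    convert! (h1.inter h2).inter h3 using 1
    ext M
    simp [posSemidef_iff_quad, Matrix.IsSymm.ext_iff]
  refine IsCompact.of_isClosed_subset (s := (Set.pi univ fun _ : Fin d => Set.pi univ fun _ : Fin d =>
      Icc (-1 : ℝ) 1 : Set (Mat d))) hK h4 ?_
  rintro (M : Mat d) ⟨hM, htr⟩ i - j -
  obtain ⟨hs, hq⟩ := posSemidef_iff_quad.1 hM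
  have hdiag : ∀ k, M k k ≤ 1 := fun k => by
    rw [← htr, Matrix.trace]
    exact Finset.single_le_sum (f := fun k => M k k) (fun k _ => hM.diag_nonneg)
      (Finset.mem_univ k)
  -- Testing on e_i ± e_j bounds |M_ij| by the mean of two diagonal entries, each at most the trace.
  have h1 := hq (Pi.single i 1 + Pi.single j 1)
  have h2 := hq (Pi.single i 1 - Pi.single j 1)
  have := hs.apply i j
  have hi := hdiag i
  have hj := hdiag j
  simp [quad, Matrix.mulVec_add, Matrix.mulVec_sub] at h1 h2
  constructor <;> linarith

theorem continuous_transfer (D : Fin n → Mat d) : Continuous (transfer D) := by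
  unfold transfer
  fun_prop

/-- The Perron-Frobenius theorem for the operator `M ↦ ∑ i, ᵗD_i M D_i`: existence. -/
theorem Irred.exists_eigenvector (hd : 0 < d) {D : Fin n → Mat d} (h : Irred D) :
    ∃ (β : ℝ) (Q : Mat d), 0 < β ∧ Q.PosDef ∧ transfer D Q = β • Q := by
  set K : Set (Mat d) := {M : Mat d | M.PosSemidef ∧ M.trace = 1} with hKdef
  have hK : IsCompact K := isCompact_posSemidef_trace_one
  obtain ⟨R, hR⟩ := hK.exists_bound_of_continuousOn (f := fun M => (transfer D M).trace)
    ((continuous_transfer D).matrix_trace).continuousOn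
  -- Collatz-Wielandt: W is the compact set of pairs (M, r) with M of trace one and r M ≤ L M. A
  -- pair with maximal r will be an eigenpair.
  set W : Set (Mat d × ℝ) := (K ×ˢ Icc 0 R) ∩
    {p | ∀ v, p.2 * quad p.1 v ≤ quad (transfer D p.1) v} with hW
  have hWc : IsCompact W := by
    refine (hK.prod isCompact_Icc).inter_right ?_
    simp only [ofPred_forall]
    refine isClosed_iInter fun v => isClosed_le ?_ ?_
    · exact continuous_snd.mul (continuous_quad.comp (continuous_fst.prodMk continuous_const))
    · exact continuous_quad.comp
        (((continuous_transfer D).comp continuous_fst).prodMk continuous_const)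
  have htr0 : ∀ M : Mat d, M.PosSemidef → M ≠ 0 → 0 < M.trace := fun M hM h0 => by
    have := hs_pos (Matrix.PosDef.one (n := Fin d) (R := ℝ)) hM h0
    simpa using this
  have hmem : ∀ (M : Mat d) (r : ℝ), M.PosSemidef → M ≠ 0 → 0 ≤ r →
      (∀ v, r * quad M v ≤ quad (transfer D M) v) → (M.trace⁻¹ • M, r) ∈ W := by
    intro M r hM h0 hr hq
    have ht := htr0 M hM h0
    have hMK : M.trace⁻¹ • M ∈ K :=
      ⟨hM.smul (inv_nonneg.2 ht.le), by simp [ht.ne']⟩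
    have hq' : ∀ v, r * quad (M.trace⁻¹ • M) v ≤ quad (transfer D (M.trace⁻¹ • M)) v := fun v => by
      rw [transfer_smul, quad_smul, quad_smul, mul_left_comm]
      exact mul_le_mul_of_nonneg_left (hq v) (by positivity)
    refine ⟨⟨hMK, hr, ?_⟩, hq'⟩
    -- Taking traces in r M ≤ L M shows that r automatically obeys the bound R.
    have h1 := hs_mono (T := 1) (M := r • (M.trace⁻¹ • M))
      (N := transfer D (M.trace⁻¹ • M)) Matrix.PosSemidef.one
      (fun v => by rw [quad_smul r]; exact hq' v)
    have h2 := (le_abs_self _).trans (hR _ hMK)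
    have h3 := hMK.2
    simp only [hs_apply, Matrix.mul_one, Matrix.trace_transpose] at h1
    rw [Matrix.trace_smul, h3, smul_eq_mul, mul_one] at h1
    exact h1.trans h2
  have h1ne : (1 : Mat d) ≠ 0 := by
    have : Nonempty (Fin d) := ⟨⟨0, hd⟩⟩
    exact one_ne_zero
  have hne : W.Nonempty := ⟨_, hmem 1 0 Matrix.PosSemidef.one h1ne le_rfl fun v => by
    rw [zero_mul, quad_transfer]
    exact Finset.sum_nonneg fun i _ => (posSemidef_iff_quad.1 Matrix.PosSemidef.one).2 _⟩
  obtain ⟨⟨Q, r⟩, hQr, hmax⟩ := hWc.exists_isMaxOn hne continuous_snd.continuousOn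
  obtain ⟨⟨⟨hQ, hQt⟩, hr0, -⟩, hq⟩ := hQr
  simp only at hQ hQt hr0 hq
  have hQs := posSemidef_iff_quad.1 hQ
  have hQ0 : Q ≠ 0 := by
    rintro rfl
    simp at hQt
  have hP := h.posDef_transfer hQ hQ0
  -- Were this semidefinite defect nonzero, its image under L would be positive definite, leaving
  -- room for L Q to satisfy the inequality with r + ε, against maximality.
  have hdiff : transfer D Q - r • Q = 0 := by
    by_contra hne
    have hpsd : (transfer D Q - r • Q).PosSemidef := by
      refine posSemidef_iff_quad.2 ⟨(transfer_isSymm D hQs.1).sub (hQs.1.smul r), fun v => ?_⟩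
      rw [quad_sub, quad_smul]
      linarith [hq v]
    have hpd := h.posDef_transfer hpsd hne
    rw [transfer_sub, transfer_smul] at hpd
    obtain ⟨ε, hε, hle⟩ := exists_smul_quad_le hd hpd (transfer D Q)
    have := hmem (transfer D Q) (r + ε) hP.posSemidef
      (fun h0 => by
        have := htr0 Q hQ hQ0
        have : Nonempty (Fin d) := ⟨⟨0, hd⟩⟩
        have hd' := hP.diag_pos (i := ⟨0, hd⟩)
        simp [h0] at hd')
      (by positivity) fun v => by
        have := hle v
        rw [quad_sub, quad_smul] at this
        linarith
    have := hmax this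
    simp at this
    linarith
  have heq : transfer D Q = r • Q := sub_eq_zero.1 hdiff
  have hr : 0 < r := by
    refine lt_of_le_of_ne hr0 fun h0 => ?_
    rw [← h0, zero_smul] at heq
    have hd' := hP.diag_pos (i := ⟨0, hd⟩)
    simp [heq] at hd'
  refine ⟨r, Q, hr, ?_, heq⟩
  have : Q = r⁻¹ • transfer D Q := by rw [heq, smul_smul, inv_mul_cancel₀ hr.ne', one_smul]
  rw [this]
  exact hP.smul (by positivity)

/-- The Perron-Frobenius theorem for the operator `M ↦ ∑ i, ᵗD_i M D_i`: uniqueness. -/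
theorem Irred.eigenvector_unique (hd : 0 < d) {D : Fin n → Mat d} (h : Irred D) {β : ℝ}
    {P R : Mat d} (hP : P.PosDef) (hPe : transfer D P = β • P) (hR : R.PosSemidef) (hR0 : R ≠ 0)
    (hRe : transfer D R = β • R) : ∃ a : ℝ, 0 < a ∧ R = a • P := by
  obtain ⟨a, v, hv, hva, hmin⟩ := exists_quad_ratio_min hd hP R
  have hRs := posSemidef_iff_quad.1 hR
  have hPs := posDef_iff_quad.1 hP
  -- As a is the least ratio, R - a P is semidefinite and vanishes at v. If nonzero, its image would
  -- be positive definite; but the image is β (R - a P), which also vanishes at v.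
  have hz : R - a • P = 0 := by
    by_contra hne
    have hpsd : (R - a • P).PosSemidef := by
      refine posSemidef_iff_quad.2 ⟨hRs.1.sub (hPs.1.smul a), fun v => ?_⟩
      rw [quad_sub, quad_smul]
      linarith [hmin v]
    have := (posDef_iff_quad.1 (h.posDef_transfer hpsd hne)).2 v hv
    rw [transfer_sub, transfer_smul, hPe, hRe, smul_comm, ← smul_sub, quad_smul, quad_sub,
      quad_smul, hva] at this
    simp at this
  have heq : R = a • P := sub_eq_zero.1 hz
  refine ⟨a, lt_of_le_of_ne ?_ ?_, heq⟩
  · have := hRs.2 v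
    rw [hva] at this
    exact nonneg_of_mul_nonneg_left this (hPs.2 v hv)
  · rintro rfl
    exact hR0 (by simpa using heq)

theorem Irred.posDef_of_eigenvector {D : Fin n → Mat d} (h : Irred D) {β : ℝ} (hβ : 0 < β)
    {R : Mat d} (hR : R.PosSemidef) (hR0 : R ≠ 0) (hRe : transfer D R = β • R) : R.PosDef := by
  have : R = β⁻¹ • transfer D R := by rw [hRe, smul_smul, inv_mul_cancel₀ hβ.ne', one_smul]
  rw [this]
  exact (h.posDef_transfer hR hR0).smul (by positivity)

/-- Eigenvalues of an operator and of its dual with positive eigenvectors agree. -/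
theorem eigenvalue_eq_of_dual {D : Fin n → Mat d} {β β' : ℝ} {Q T : Mat d} (hQ : Q.PosDef)
    (hT : T.PosSemidef) (hT0 : T ≠ 0) (hQe : transfer D Q = β • Q)
    (hTe : transfer (fun i => (D i)ᵀ) T = β' • T) : β = β' := by
  have h := hs_transfer D Q T
  rw [hQe, hTe, map_smul, FunLike.coe_smul, Pi.smul_apply, map_smul] at h
  exact mul_right_cancel₀ (hs_pos hQ hT hT0).ne' h

end Fractal

/-! ### Integrals against vector measures. -/

namespace Fractal

section VectorIntegral

variable {X E E' F F' : Type*} [MeasurableSpace X]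
  [NormedAddCommGroup E] [NormedSpace ℝ E] [NormedAddCommGroup E'] [NormedSpace ℝ E']
  [NormedAddCommGroup F] [NormedSpace ℝ F] [NormedAddCommGroup F'] [NormedSpace ℝ F']

omit [NormedSpace ℝ F] in
theorem isFiniteMeasure_variation_of_norm_le {τ : VectorMeasure X F} {μ : Measure X} [IsFiniteMeasure μ]
    (c : ℝ≥0) (h : ∀ B, MeasurableSet B → ‖τ B‖ ≤ c * μ.real B) : IsFiniteMeasure τ.variation := by
  refine isFiniteMeasure_of_le (c • μ) (VectorMeasure.variation_le_of_forall_enorm_le fun B hB => ?_)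
  have := h B hB
  rw [Measure.smul_apply, ← ofReal_norm, ENNReal.smul_def, smul_eq_mul]
  refine ENNReal.ofReal_le_of_le_toReal ?_
  rw [ENNReal.toReal_mul]
  exact this

/-- Moves a linear map from the integrand to the measure. The hypothesis is the case of indicators;
simple functions follow by additivity and bounded measurable ones by dominated convergence on both
sides. -/
theorem integral_comp_clm (τ : VectorMeasure X F) [IsFiniteMeasure τ.variation]
    (τ' : VectorMeasure X F') [IsFiniteMeasure τ'.variation]
    (B : E' →L[ℝ] F →L[ℝ] ℝ) (B' : E →L[ℝ] F' →L[ℝ] ℝ) (φ : E →L[ℝ] E')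
    (h : ∀ e s, MeasurableSet s → B (φ e) (τ s) = B' e (τ' s)) {f : X → E}
    (hf : StronglyMeasurable f) {C : ℝ} (hC : ∀ x, ‖f x‖ ≤ C) :
    τ.integral (fun x => φ (f x)) B = τ'.integral f B' := by
  have hsimple : ∀ g : SimpleFunc X E, τ.integral (fun x => φ (g x)) B = τ'.integral g B' := by
    intro g
    induction g using SimpleFunc.induction with
    | const c hs =>
      rename_i s
      have h1 : (fun x => φ ((SimpleFunc.piecewise s hs (SimpleFunc.const X c)
          (SimpleFunc.const X 0)) x)) = s.indicator fun _ => φ c := by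
        ext x
        by_cases hx : x ∈ s <;> simp [hx]
      have h2 : ⇑(SimpleFunc.piecewise s hs (SimpleFunc.const X c) (SimpleFunc.const X 0)) =
          s.indicator fun _ => c := by
        ext x
        by_cases hx : x ∈ s <;> simp [hx]
      rw [h1, h2, VectorMeasure.integral_indicator_const _ hs,
        VectorMeasure.integral_indicator_const _ hs, h c s hs]
    | add hdisj hf hg =>
      rename_i f g
      have hi : ∀ g : SimpleFunc X E, τ.Integrable fun x => φ (g x) := fun g =>
        φ.integrable_comp (SimpleFunc.integrable_of_isFiniteMeasure g)
      have hi' : ∀ g : SimpleFunc X E, τ'.Integrable g := fun g =>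
        SimpleFunc.integrable_of_isFiniteMeasure g
      simp only [SimpleFunc.coe_add, Pi.add_apply, map_add]
      rw [VectorMeasure.integral_fun_add (hi f) (hi g), hf, hg,
        ← VectorMeasure.integral_add (hi' f) (hi' g)]
  have hb : ∀ x, ‖f x‖ ≤ max C 0 := fun x => (hC x).trans (le_max_left _ _)
  have hlim : ∀ x, Filter.Tendsto (fun k => hf.approxBounded (max C 0) k x) Filter.atTop
      (nhds (f x)) := fun x => hf.tendsto_approxBounded_of_norm_le (hb x)
  have h1 : Filter.Tendsto (fun k => τ.integral (fun x => φ (hf.approxBounded (max C 0) k x)) B)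
      Filter.atTop (nhds (τ.integral (fun x => φ (f x)) B)) := by
    refine VectorMeasure.tendsto_integral_filter_of_norm_le_const
      (Filter.Eventually.of_forall fun k => ?_)
      ⟨‖φ‖ * max C 0, Filter.Eventually.of_forall fun k => Filter.Eventually.of_forall fun x => ?_⟩
      (Filter.Eventually.of_forall fun x => (φ.continuous.tendsto _).comp (hlim x))
    · exact (φ.continuous.comp_stronglyMeasurable
        (SimpleFunc.stronglyMeasurable _)).aestronglyMeasurable
    · exact (φ.le_opNorm _).trans (mul_le_mul_of_nonneg_left
        (hf.norm_approxBounded_le (le_max_right _ _) k x) (norm_nonneg _))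
  have h2 : Filter.Tendsto (fun k => τ'.integral (hf.approxBounded (max C 0) k) B')
      Filter.atTop (nhds (τ'.integral f B')) := by
    refine VectorMeasure.tendsto_integral_filter_of_norm_le_const
      (Filter.Eventually.of_forall fun k => ?_)
      ⟨max C 0, Filter.Eventually.of_forall fun k => Filter.Eventually.of_forall fun x => ?_⟩
      (Filter.Eventually.of_forall hlim)
    · exact (SimpleFunc.stronglyMeasurable _).aestronglyMeasurable
    · exact hf.norm_approxBounded_le (le_max_right _ _) k x
  simp only [hsimple] at h1
  exact tendsto_nhds_unique h1 h2

end VectorIntegral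

/-! ### Linear relations between finite measures. -/

section LinearRelations

variable {X ι : Type*} [MeasurableSpace X] [TopologicalSpace X] [BorelSpace X]
  [HasOuterApproxClosed X]

/-- A linear relation between the integrals of bounded continuous functions with respect to finite
measures is a linear relation between the measures. -/
theorem sum_measureReal_eq_zero (s : Finset ι) (c : ι → ℝ) (p : ι → Measure X)
    [∀ k, IsFiniteMeasure (p k)]
    (h : ∀ f : BoundedContinuousFunction X ℝ, ∑ k ∈ s, c k * ∫ x, f x ∂(p k) = 0) (B : Set X) :
    ∑ k ∈ s, c k * (p k).real B = 0 := by
  have hint : ∀ (a : ι → ℝ) (f : BoundedContinuousFunction X ℝ),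
      ∫ x, f x ∂(∑ k ∈ s, (a k).toNNReal • p k) = ∑ k ∈ s, max (a k) 0 * ∫ x, f x ∂(p k) := by
    intro a f
    rw [integral_finsetSum_measure fun k _ => f.integrable _]
    refine Finset.sum_congr rfl fun k _ => ?_
    rw [integral_smul_nnreal_measure, NNReal.smul_def, smul_eq_mul, Real.coe_toNNReal']
  have hreal : ∀ a : ι → ℝ, (∑ k ∈ s, (a k).toNNReal • p k).real B =
      ∑ k ∈ s, max (a k) 0 * (p k).real B := by
    intro a
    rw [measureReal_def, Measure.finsetSum_apply, ENNReal.toReal_sum fun k _ => measure_ne_top _ _]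
    refine Finset.sum_congr rfl fun k _ => ?_
    rw [← measureReal_def, measureReal_nnreal_smul_apply, Real.coe_toNNReal']
  -- Putting the terms with negative coefficients on the other side leaves two positive finite
  -- measures, which bounded continuous functions separate.
  have heq : ∑ k ∈ s, (c k).toNNReal • p k = ∑ k ∈ s, (-c k).toNNReal • p k := by
    refine ext_of_forall_integral_eq_of_IsFiniteMeasure fun f => ?_
    rw [hint, hint fun k => -c k, ← sub_eq_zero, ← Finset.sum_sub_distrib]
    refine Eq.trans ?_ (h f)
    refine Finset.sum_congr rfl fun k _ => ?_
    rw [← sub_mul, max_zero_sub_max_neg_zero_eq_self]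
  have h1 := hreal c
  rw [heq, hreal fun k => -c k, eq_comm, ← sub_eq_zero, ← Finset.sum_sub_distrib] at h1
  rw [← h1]
  refine Finset.sum_congr rfl fun k _ => ?_
  rw [← sub_mul, max_zero_sub_max_neg_zero_eq_self]

end LinearRelations

/-! ### Measures with semidefinite matrix values. -/

section MatrixMeasure

variable {d : ℕ} {X : Type*} [MeasurableSpace X]

/-- Passes between the entrywise topology and that of the Frobenius norm, which are definitionally
equal but come from different instances. -/
theorem continuous_iff_continuous_norm {Y : Type*} [TopologicalSpace Y] {A : Y → Mat d} :
    Continuous A ↔ @Continuous Y (Mat d) _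
      (inferInstance : NormedAddCommGroup
        (Mat d)).toMetricSpace.toUniformSpace.toTopologicalSpace A := Iff.rfl

theorem exists_measure_hs {τ : NormedMeasure X (Mat d)}
    (hτ : ∀ B, MeasurableSet B → (τ B).PosSemidef) {M : Mat d} (hM : ∀ v, 0 ≤ quad M v) :
    ∃ μ : Measure X, IsFiniteMeasure μ ∧ ∀ B, MeasurableSet B → hs d M (τ B) = μ.real B := by
  let s : SignedMeasure X := τ.mapRange (hs d M).toAddMonoidHom (hs d M).continuous
  have hs0 : 0 ≤[univ] s := fun B hB => by
    rw [VectorMeasure.restrict_univ, VectorMeasure.restrict_univ]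
    exact hs_nonneg hM (hτ B hB)
  refine ⟨s.toMeasureOfZeroLE univ .univ hs0, inferInstance, fun B hB => ?_⟩
  rw [SignedMeasure.toMeasureOfZeroLE_real_apply _ _ _ hB, univ_inter]
  rfl

theorem exists_norm_le_trace (d : ℕ) :
    ∃ c : ℝ≥0, ∀ T : Mat d, T.PosSemidef → ‖T‖ ≤ c * T.trace := by
  obtain ⟨C, hC⟩ := isCompact_posSemidef_trace_one.exists_bound_of_continuousOn
    (f := fun M : Mat d => ‖M‖) (by
      have : Continuous fun M : Mat d => ‖M‖ := continuous_norm
      exact this.continuousOn)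
  refine ⟨C.toNNReal, fun T hT => ?_⟩
  rcases eq_or_ne T 0 with rfl | h0
  · simp
  have ht : 0 < T.trace := by
    simpa using hs_pos (Matrix.PosDef.one (n := Fin d) (R := ℝ)) hT h0
  have := hC (T.trace⁻¹ • T) ⟨hT.smul (inv_nonneg.2 ht.le), by simp [ht.ne']⟩
  rw [norm_norm, norm_smul, norm_inv, Real.norm_of_nonneg ht.le, inv_mul_le_iff₀ ht] at this
  rw [mul_comm]
  exact this.trans (mul_le_mul_of_nonneg_left (Real.le_coe_toNNReal C) ht.le)

/-- On semidefinite matrices the trace dominates the norm, and the trace of τ is a finite positive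
measure. This makes continuous functions integrable. -/
theorem isFiniteMeasure_variation {τ : NormedMeasure X (Mat d)}
    (hτ : ∀ B, MeasurableSet B → (τ B).PosSemidef) : IsFiniteMeasure τ.variation := by
  obtain ⟨μ, hμ, h⟩ := exists_measure_hs hτ (M := 1)
    (posSemidef_iff_quad.1 Matrix.PosSemidef.one).2
  obtain ⟨c, hc⟩ := exists_norm_le_trace d
  refine isFiniteMeasure_variation_of_norm_le (μ := μ) c fun B hB => ?_
  rw [← h B hB]
  simpa using hc _ (hτ B hB)

variable [TopologicalSpace X] [CompactSpace X] [BorelSpace X]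

omit [MeasurableSpace X] [BorelSpace X] in
theorem exists_norm_le_of_continuous {E : Type*} [NormedAddCommGroup E] {f : X → E}
    (hf : Continuous f) : ∃ C, ∀ x, ‖f x‖ ≤ C := by
  obtain ⟨C, hC⟩ := isCompact_univ.exists_bound_of_continuousOn hf.continuousOn
  exact ⟨C, fun x => hC x (mem_univ x)⟩

/-- The integral of `f M`, for a scalar function `f` and a constant matrix `M`. -/
theorem integral_smul_const_hs {τ : NormedMeasure X (Mat d)}
    (hτ : ∀ B, MeasurableSet B → (τ B).PosSemidef) {M : Mat d} {μ : Measure X} [IsFiniteMeasure μ]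
    (hμ : ∀ B, MeasurableSet B → hs d M (τ B) = μ.real B) {f : X → ℝ} (hf : Continuous f) :
    τ.integral (fun x => f x • M) (hs d) = ∫ x, f x ∂μ := by
  have := isFiniteMeasure_variation hτ
  obtain ⟨C, hC⟩ := exists_norm_le_of_continuous hf
  have hv : IsFiniteMeasure μ.toSignedMeasure.variation := by
    rw [Measure.variation_toSignedMeasure]; infer_instance
  rw [← VectorMeasure.integral_toSignedMeasure]
  refine integral_comp_clm τ μ.toSignedMeasure (hs d) _
    ((ContinuousLinearMap.id ℝ ℝ).smulRight M) (fun e s hs' => ?_) hf.stronglyMeasurable hC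
  simp [Measure.toSignedMeasure_apply_measurable hs', ← hμ s hs', mul_comm]

end MatrixMeasure

end Fractal

/-! ### The Ruelle operator flattens continuous functions. -/

namespace Fractal

theorem jac_mulVec {d : ℕ} (f : Euc d → Euc d) (x : Euc d) (v : Fin d → ℝ) :
    jac f x *ᵥ v = WithLp.ofLp (fderiv ℝ f x (WithLp.toLp 2 v)) := by
  have hv : WithLp.toLp 2 v = ∑ l, v l • EuclideanSpace.single l (1 : ℝ) := by
    ext k
    simp [Finset.sum_apply, Pi.single_apply]
  ext k
  rw [hv, map_sum]
  simp [jac, Matrix.mulVec, dotProduct, mul_comm]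

namespace IFS

variable {d n : ℕ} (S : IFS d n)

instance : CompactSpace S.G := isCompact_iff_compactSpace.1 S.isCompact

instance : Nonempty S.G := S.nonempty.to_subtype

theorem exists_dist_branch_le : ∃ η : ℝ, 0 ≤ η ∧ η < 1 ∧ ∀ i x y,
    dist (S.branch i x) (S.branch i y) ≤ η * dist x y := by
  obtain ⟨η, h1, h⟩ := S.contracting
  exact ⟨η, η.2, by exact_mod_cast h1, fun i x y => (h i).dist_le_mul x y⟩

theorem continuous_branch (i : Fin n) : Continuous (S.branch i) :=
  ((S.contDiff i).continuous.comp continuous_subtype_val).subtype_mk _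

theorem injective_branch (i : Fin n) : Function.Injective (S.branch i) := by
  obtain ⟨g, -, hg, -⟩ := S.diffeo i
  intro x y h
  exact Subtype.ext (hg.injective (congrArg Subtype.val h))

variable {S} {D : Fin n → Mat d}

theorem irred_of_nondegenerate (hND : S.Nondegenerate) (hD : ∀ i x, jac (S.ψ i) x = D i) :
    Irred D := by
  obtain ⟨b, hb, h⟩ := hND
  obtain ⟨x, hx⟩ := S.nonempty
  intro v w hv hw
  obtain ⟨i, hi⟩ := h x hx (WithLp.toLp 2 v) (WithLp.toLp 2 w)
  refine ⟨i, fun h0 => ?_⟩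
  rw [EuclideanSpace.inner_eq_star_dotProduct, ← jac_mulVec, hD, star_trivial] at hi
  rw [show (WithLp.toLp 2 w).ofLp = w from rfl, h0, abs_zero] at hi
  have h1 : 0 < ‖WithLp.toLp 2 v‖ := norm_pos_iff.2 (by simpa using hv)
  have h2 : 0 < ‖WithLp.toLp 2 w‖ := norm_pos_iff.2 (by simpa using hw)
  have : 0 < b * ‖WithLp.toLp 2 v‖ * ‖WithLp.toLp 2 w‖ := by positivity
  linarith

/-- The chain rule for a differentiable inverse of ψ_i gives the derivative a left inverse. -/
theorem eq_zero_of_mulVec_eq_zero (hD : ∀ i x, jac (S.ψ i) x = D i) (i : Fin n) {v : Fin d → ℝ}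
    (hv : D i *ᵥ v = 0) : v = 0 := by
  obtain ⟨g, hg, hl, -⟩ := S.diffeo i
  have h1 : fderiv ℝ (g ∘ S.ψ i) 0 = ContinuousLinearMap.id ℝ (Euc d) := by
    rw [hl.comp_eq_id, fderiv_id]
  rw [fderiv_comp _ (hg.differentiable (by simp) _) ((S.contDiff i).differentiable (by simp) _)] at h1
  rw [← hD i 0, jac_mulVec] at hv
  have h2 := congrArg (fun L => L (WithLp.toLp 2 v)) h1
  simp only [ContinuousLinearMap.comp_apply, ContinuousLinearMap.id_apply] at h2
  rw [show fderiv ℝ (S.ψ i) 0 (WithLp.toLp 2 v) = 0 from (WithLp.ofLp_injective 2) hv, map_zero] at h2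
  simpa using h2.symm

theorem ruelle_eq (hD : ∀ i x, jac (S.ψ i) x = D i) (A : S.G → Mat d) (x : S.G) :
    S.ruelle A x = ∑ i, (D i)ᵀ * A (S.branch i x) * D i := by
  simp only [ruelle, hD]

theorem ruelle_const (hD : ∀ i x, jac (S.ψ i) x = D i) (M : Mat d) (x : S.G) :
    S.ruelle (fun _ => M) x = transfer D M := ruelle_eq hD _ _

theorem quad_ruelle (hD : ∀ i x, jac (S.ψ i) x = D i) (A : S.G → Mat d) (x : S.G)
    (v : Fin d → ℝ) : quad (S.ruelle A x) v = ∑ i, quad (A (S.branch i x)) (D i *ᵥ v) := by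
  simp only [ruelle_eq hD, quad_sum, quad_conj]

variable (S) in
/-- The Ruelle operator, divided by `β`. -/
noncomputable def normRuelle (β : ℝ) (A : S.G → Mat d) (x : S.G) : Mat d := β⁻¹ • S.ruelle A x

/-- At scale `δ`, the oscillation of `A` is at most `s Q`, in the sense of quadratic forms. -/
def OscLE (A Q : S.G → Mat d) (δ s : ℝ) : Prop :=
  ∀ x y, dist x y ≤ δ → ∀ v, |quad (A x) v - quad (A y) v| ≤ s * quad (Q y) v

/-- On the compact product of G and the unit sphere, the form of A is uniformly continuous and that
of Q has a positive minimum c; homogeneity covers all vectors. -/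
theorem exists_oscLE (hd : 0 < d) {A Q : S.G → Mat d} (hA : Continuous A) (hQ : Continuous Q)
    (hQp : ∀ x, (Q x).PosDef) {s : ℝ} (hs : 0 < s) : ∃ δ, 0 < δ ∧ OscLE A Q δ s := by
  have : Nonempty (Fin d) := ⟨⟨0, hd⟩⟩
  let Sp := Metric.sphere (0 : Fin d → ℝ) 1
  have : Nonempty Sp := (NormedSpace.sphere_nonempty.2 zero_le_one).to_subtype
  have hcont : ∀ M : S.G → Mat d, Continuous M →
      Continuous fun p : S.G × Sp => quad (M p.1) p.2 := fun M hM =>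
    continuous_quad.comp ((hM.comp continuous_fst).prodMk
      (continuous_subtype_val.comp continuous_snd))
  obtain ⟨⟨x0, u0⟩, -, hmin⟩ := isCompact_univ.exists_isMinOn univ_nonempty
    (hcont Q hQ).continuousOn
  have hu0 : (u0 : Fin d → ℝ) ≠ 0 := by
    intro h
    have := u0.2
    simp [Sp, h] at this
  set c := quad (Q x0) u0
  have hc : 0 < c := (posDef_iff_quad.1 (hQp x0)).2 _ hu0
  have hunif := CompactSpace.uniformContinuous_of_continuous (hcont A hA)
  obtain ⟨δ, hδ, h⟩ := Metric.uniformContinuous_iff.1 hunif (s * c) (by positivity)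
  refine ⟨δ / 2, by positivity, fun x y hxy v => ?_⟩
  rcases eq_or_ne v 0 with rfl | hv
  · simp [quad]
  have hnv : 0 < ‖v‖ := norm_pos_iff.2 hv
  let u : Sp := ⟨‖v‖⁻¹ • v, by simp [Sp, norm_smul, hnv.ne']⟩
  have huv : v = ‖v‖ • (u : Fin d → ℝ) := by simp [u, smul_smul, hnv.ne']
  have h1 := h (a := (x, u)) (b := (y, u)) (by
    rw [Prod.dist_eq, dist_self, max_eq_left dist_nonneg]
    linarith)
  have h2 : c ≤ quad (Q y) u := hmin (mem_univ (y, u))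
  rw [Real.dist_eq] at h1
  rw [huv, quad_smul_right (A x) ‖v‖ u, quad_smul_right (A y) ‖v‖ u,
    quad_smul_right (Q y) ‖v‖ u, ← mul_sub, abs_mul,
    abs_of_nonneg (sq_nonneg _), mul_left_comm]
  refine mul_le_mul_of_nonneg_left ?_ (sq_nonneg _)
  exact h1.le.trans (mul_le_mul_of_nonneg_left h2 hs.le)

/-- Branches shrink distances by η, so scale δ for the image only sees scale ηδ for A. The bound s Q
is reproduced because Q is an eigenfunction. -/
theorem OscLE.normRuelle (hD : ∀ i x, jac (S.ψ i) x = D i) {β : ℝ} (hβ : 0 < β)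
    {A Q : S.G → Mat d} (hQ : ∀ x, S.ruelle Q x = β • Q x) {η δ s : ℝ} (hη : 0 ≤ η)
    (hcontr : ∀ i x y, dist (S.branch i x) (S.branch i y) ≤ η * dist x y)
    (h : OscLE A Q (η * δ) s) : OscLE (S.normRuelle β A) Q δ s := by
  intro x y hxy v
  rw [IFS.normRuelle, IFS.normRuelle, quad_smul, quad_smul, quad_ruelle hD, quad_ruelle hD,
    ← mul_sub, ← Finset.sum_sub_distrib, abs_mul, abs_of_pos (inv_pos.2 hβ),
    inv_mul_le_iff₀ hβ]
  calc |∑ i, (quad (A (S.branch i x)) (D i *ᵥ v) - quad (A (S.branch i y)) (D i *ᵥ v))|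
      ≤ ∑ i, |quad (A (S.branch i x)) (D i *ᵥ v) - quad (A (S.branch i y)) (D i *ᵥ v)| :=
        Finset.abs_sum_le_sum_abs _ _
    _ ≤ ∑ i, s * quad (Q (S.branch i y)) (D i *ᵥ v) := Finset.sum_le_sum fun i _ =>
        h _ _ ((hcontr i x y).trans (mul_le_mul_of_nonneg_left hxy hη)) _
    _ = s * quad (S.ruelle Q y) v := by rw [quad_ruelle hD, Finset.mul_sum]
    _ = β * (s * quad (Q y) v) := by rw [hQ, quad_smul]; ring

theorem OscLE.iterate_normRuelle (hD : ∀ i x, jac (S.ψ i) x = D i) {β : ℝ} (hβ : 0 < β)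
    {A Q : S.G → Mat d} (hQ : ∀ x, S.ruelle Q x = β • Q x) {η s : ℝ} (hη : 0 ≤ η)
    (hcontr : ∀ i x y, dist (S.branch i x) (S.branch i y) ≤ η * dist x y) (l : ℕ) (δ : ℝ)
    (h : OscLE A Q (η ^ l * δ) s) : OscLE ((S.normRuelle β)^[l] A) Q δ s := by
  induction l generalizing δ with
  | zero => simpa using h
  | succ l ih =>
    rw [Function.iterate_succ_apply']
    refine OscLE.normRuelle hD hβ hQ hη hcontr (ih _ ?_)
    rwa [← mul_assoc, ← pow_succ]

/-- The iterates of the normalised Ruelle operator are asymptotically constant. -/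
theorem eventually_oscLE (hd : 0 < d) (hD : ∀ i x, jac (S.ψ i) x = D i) {β : ℝ} (hβ : 0 < β)
    {A Q : S.G → Mat d} (hA : Continuous A) (hQ : Continuous Q) (hQp : ∀ x, (Q x).PosDef)
    (hQe : ∀ x, S.ruelle Q x = β • Q x) {s : ℝ} (hs : 0 < s) :
    ∀ᶠ l in Filter.atTop, ∀ x y v,
      |quad ((S.normRuelle β)^[l] A x) v - quad ((S.normRuelle β)^[l] A y) v| ≤
        s * quad (Q y) v := by
  obtain ⟨η, hη, hη1, hcontr⟩ := S.exists_dist_branch_le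
  obtain ⟨δ, hδ, hosc⟩ := exists_oscLE hd hA hQ hQp hs
  have hlim : Filter.Tendsto (fun l => η ^ l * Metric.diam (univ : Set S.G)) Filter.atTop
      (nhds 0) := by
    simpa using (tendsto_pow_atTop_nhds_zero_of_lt_one hη hη1).mul_const
      (Metric.diam (univ : Set S.G))
  filter_upwards [hlim.eventually_lt_const hδ] with l hl x y v
  exact OscLE.iterate_normRuelle hD hβ hQe hη hcontr l _
    (fun x y hxy => hosc x y (hxy.trans hl.le)) x y
    (Metric.dist_le_diam_of_mem isCompact_univ.isBounded (mem_univ x) (mem_univ y)) v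

/-- Q is fixed by an operator whose iterates flatten every continuous function. -/
theorem eigenfunction_eq (hd : 0 < d) (hD : ∀ i x, jac (S.ψ i) x = D i) {β : ℝ} (hβ : 0 < β)
    {Q : S.G → Mat d} (hQ : Continuous Q) (hQp : ∀ x, (Q x).PosDef)
    (hQe : ∀ x, S.ruelle Q x = β • Q x) (x y : S.G) : Q x = Q y := by
  have hfix : S.normRuelle β Q = Q := by
    funext x
    rw [normRuelle, hQe, smul_smul, inv_mul_cancel₀ hβ.ne', one_smul]
  have hiter : ∀ l, (S.normRuelle β)^[l] Q = Q := fun l => Function.iterate_fixed hfix l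
  refine eq_of_quad_eq (posDef_iff_quad.1 (hQp x)).1 (posDef_iff_quad.1 (hQp y)).1 fun v => ?_
  rw [← sub_eq_zero, ← abs_nonpos_iff]
  refine le_of_forall_pos_le_add fun ε hε => ?_
  have hq := (posSemidef_iff_quad.1 (hQp y).posSemidef).2 v
  obtain ⟨l, hl⟩ := (eventually_oscLE hd hD hβ hQ hQ hQp hQe
    (s := ε / (quad (Q y) v + 1)) (by positivity)).exists
  have := hl x y v
  rw [hiter] at this
  refine this.trans ?_
  rw [zero_add, div_mul_eq_mul_div, div_le_iff₀ (by positivity)]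
  nlinarith

end IFS

end Fractal

/-! ### Gibbs equation and self-similarity of matrix measures. -/

namespace Fractal

namespace IFS

variable {d n : ℕ} {S : IFS d n} {D : Fin n → Mat d}

variable (S) in
/-- A matrix-valued measure with `β τ(B) = ∑ i, D_i τ(ψ_i⁻¹ B) ᵗD_i`. -/
structure IsSelfSimilar (D : Fin n → Mat d) (β : ℝ) (τ : NormedMeasure S.G (Mat d)) : Prop where
  posSemidef : ∀ B, MeasurableSet B → (τ B).PosSemidef
  scaling : ∀ B, MeasurableSet B → β • τ B = ∑ i, D i * τ (S.branch i ⁻¹' B) * (D i)ᵀ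

theorem measurable_branch (i : Fin n) : Measurable (S.branch i) := (S.continuous_branch i).measurable

/-- Positive measures which satisfy the self-similarity relation weakly satisfy it. -/
theorem measureReal_selfSimilar {β : ℝ} (μ : (Fin d → ℝ) → Measure S.G)
    [∀ v, IsFiniteMeasure (μ v)] {v : Fin d → ℝ}
    (h : ∀ f : S.G → ℝ, Continuous f →
      β * ∫ x, f x ∂(μ v) = ∑ i, ∫ x, f (S.branch i x) ∂(μ ((D i)ᵀ *ᵥ v)))
    {B : Set S.G} (hB : MeasurableSet B) :
    β * (μ v).real B = ∑ i, (μ ((D i)ᵀ *ᵥ v)).real (S.branch i ⁻¹' B) := by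
  let p : Option (Fin n) → Measure S.G := fun o => o.elim (μ v) fun i =>
    (μ ((D i)ᵀ *ᵥ v)).map (S.branch i)
  have hp : ∀ o, IsFiniteMeasure (p o) := by
    rintro (_ | i)
    · exact inferInstanceAs (IsFiniteMeasure (μ v))
    · exact inferInstanceAs (IsFiniteMeasure ((μ ((D i)ᵀ *ᵥ v)).map (S.branch i)))
  have key := sum_measureReal_eq_zero Finset.univ (fun o : Option (Fin n) => o.elim (-β) fun _ => 1)
    p (fun f => by
      rw [Fintype.sum_option]
      simp only [Option.elim, p, one_mul]
      have h1 := h f f.continuous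
      rw [neg_mul, h1, neg_add_eq_zero]
      refine Finset.sum_congr rfl fun i _ => ?_
      rw [integral_map (measurable_branch i).aemeasurable
        f.continuous.measurable.aestronglyMeasurable]) B
  rw [Fintype.sum_option] at key
  simp only [Option.elim, p, one_mul] at key
  rw [neg_mul, neg_add_eq_zero] at key
  rw [key]
  refine Finset.sum_congr rfl fun i _ => ?_
  rw [map_measureReal_apply (measurable_branch i) hB]

theorem quad_vecMulVec_nonneg (v w : Fin d → ℝ) : 0 ≤ quad (Matrix.vecMulVec v v) w := by
  rw [quad, Matrix.vecMulVec_mulVec]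
  simp [dotProduct_comm w v, mul_self_nonneg]

theorem conj_vecMulVec (C : Mat d) (v : Fin d → ℝ) :
    Cᵀ * Matrix.vecMulVec v v * C = Matrix.vecMulVec (Cᵀ *ᵥ v) (Cᵀ *ᵥ v) := by
  rw [Matrix.mul_vecMulVec, Matrix.vecMulVec_mul, Matrix.mulVec_transpose]

theorem ruelle_smul_vecMulVec (hD : ∀ i x, jac (S.ψ i) x = D i) (f : S.G → ℝ) (v : Fin d → ℝ) :
    S.ruelle (fun x => f x • Matrix.vecMulVec v v) = fun x => ∑ i,
      f (S.branch i x) • Matrix.vecMulVec ((D i)ᵀ *ᵥ v) ((D i)ᵀ *ᵥ v) := by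
  funext x
  simp only [ruelle_eq hD, Matrix.mul_smul, Matrix.smul_mul, conj_vecMulVec]

theorem integrable_of_continuous {τ : NormedMeasure S.G (Mat d)} [IsFiniteMeasure τ.variation]
    {A : S.G → Mat d} (hA : Continuous A) : τ.Integrable A := by
  obtain ⟨C, hC⟩ := exists_norm_le_of_continuous (continuous_iff_continuous_norm.1 hA)
  exact Integrable.of_bound
    (continuous_iff_continuous_norm.1 hA).stronglyMeasurable.aestronglyMeasurable C
    (Filter.Eventually.of_forall hC)

/-- Test the dual equation on f v⊗v: the Ruelle operator yields a sum of functions of the same shape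
with v replaced by ᵗD_i v, hence a relation between the scalar measures (τ v, v), and these
determine τ. -/
theorem IsGibbs.isSelfSimilar (hD : ∀ i x, jac (S.ψ i) x = D i) {β : ℝ} {Q : S.G → Mat d}
    {τ : NormedMeasure S.G (Mat d)} (h : S.IsGibbs β Q τ) : S.IsSelfSimilar D β τ := by
  have hfin := isFiniteMeasure_variation h.posSemidef
  refine ⟨h.posSemidef, fun B hB => ?_⟩
  have hsymm : ∀ B, MeasurableSet B → (τ B).IsSymm := fun B hB =>
    (posSemidef_iff_quad.1 (h.posSemidef B hB)).1
  refine eq_of_quad_eq ((hsymm B hB).smul β)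
    (isSymm_sum _ fun i _ => isSymm_conj' (hsymm _ (measurable_branch i hB)) _) fun v => ?_
  choose μ hμf hμ using fun w : Fin d → ℝ => exists_measure_hs h.posSemidef (quad_vecMulVec_nonneg w)
  have hreal : ∀ w B, MeasurableSet B → quad (τ B) w = (μ w).real B := fun w B hB => by
    rw [← hμ w B hB, hs_vecMulVec]
  have hqc : ∀ i, quad (D i * τ (S.branch i ⁻¹' B) * (D i)ᵀ) v =
      quad (τ (S.branch i ⁻¹' B)) ((D i)ᵀ *ᵥ v) := fun i => by
    simpa using quad_conj (τ (S.branch i ⁻¹' B)) (D i)ᵀ v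
  rw [quad_smul, quad_sum, hreal v B hB]
  simp only [hqc, fun i => hreal ((D i)ᵀ *ᵥ v) _ (measurable_branch i hB)]
  refine measureReal_selfSimilar μ (fun f hf => ?_) hB
  have h1 := h.dual_eigen (fun x => f x • Matrix.vecMulVec v v) (hf.smul continuous_const)
    (fun x => by simp [Matrix.IsSymm, Matrix.transpose_vecMulVec])
  rw [integral_smul_const_hs h.posSemidef (hμ v) hf, ruelle_smul_vecMulVec hD,
    VectorMeasure.integral_finsetSum] at h1
  · rw [← h1]
    refine Finset.sum_congr rfl fun i _ => ?_
    exact integral_smul_const_hs h.posSemidef (hμ ((D i)ᵀ *ᵥ v)) (hf.comp (S.continuous_branch i))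
  · exact fun i _ => integrable_of_continuous
      ((hf.comp (S.continuous_branch i)).smul continuous_const)

/-- The linear map `T ↦ C T ᵗC`. -/
noncomputable def conjMap (C : Mat d) : Mat d →L[ℝ] Mat d :=
  LinearMap.toContinuousLinearMap
    { toFun := fun T => C * T * Cᵀ
      map_add' := fun A B => by simp [Matrix.mul_add, Matrix.add_mul]
      map_smul' := fun c A => by simp }

/-- Self-similarity writes β τ as the sum of the push-forwards of D_i τ ᵗD_i; the conjugation then
passes to the integrand by duality. -/
theorem IsSelfSimilar.integral_ruelle (hD : ∀ i x, jac (S.ψ i) x = D i) {β : ℝ}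
    {τ : NormedMeasure S.G (Mat d)} (h : S.IsSelfSimilar D β τ) {A : S.G → Mat d}
    (hA : Continuous A) : τ.integral (S.ruelle A) (hs d) = β * τ.integral A (hs d) := by
  have hfin := isFiniteMeasure_variation h.posSemidef
  let τ₁ : Fin n → NormedMeasure S.G (Mat d) := fun i =>
    τ.mapRange (conjMap (D i)).toAddMonoidHom (conjMap (D i)).continuous
  have hτ₁ : ∀ i B, τ₁ i B = D i * τ B * (D i)ᵀ := fun i B => rfl
  have hpsd : ∀ i B, MeasurableSet B → (τ₁ i B).PosSemidef := fun i B hB => by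
    rw [hτ₁]
    exact posSemidef_conj' (h.posSemidef B hB) _
  have hfin₁ : ∀ i, IsFiniteMeasure (τ₁ i).variation := fun i => isFiniteMeasure_variation (hpsd i)
  have hsum : ∑ i, (τ₁ i).map (S.branch i) = β • τ := by
    ext B hB : 1
    rw [smul_apply, h.scaling B hB, FunLike.coe_sum, Finset.sum_apply]
    refine Finset.sum_congr rfl fun i _ => ?_
    rw [VectorMeasure.map_apply _ (measurable_branch i) hB, hτ₁]
  have hr : S.ruelle A = fun x => ∑ i, (D i)ᵀ * A (S.branch i x) * D i := funext (ruelle_eq hD A)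
  have hcomp : ∀ i, Continuous fun x => A (S.branch i x) := fun i =>
    hA.comp (S.continuous_branch i)
  rw [hr, VectorMeasure.integral_finsetSum, ← smul_eq_mul,
    ← VectorMeasure.integral_smul_vectorMeasure, ← hsum,
    VectorMeasure.integral_finsetSum_vectorMeasure]
  · refine Finset.sum_congr rfl fun i _ => ?_
    rw [VectorMeasure.integral_map (measurable_branch i)
      (continuous_iff_continuous_norm.1 hA).stronglyMeasurable.aestronglyMeasurable
      (integrable_of_continuous (hcomp i))]
    obtain ⟨C, hC⟩ := exists_norm_le_of_continuous (continuous_iff_continuous_norm.1 (hcomp i))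
    have : τ.integral (fun x => (D i)ᵀ * A (S.branch i x) * (D i)ᵀᵀ) (hs d) =
        (τ₁ i).integral (fun x => A (S.branch i x)) (hs d) :=
      integral_comp_clm τ (τ₁ i) (hs d) (hs d) (conjMap (D i)ᵀ)
        (fun M B _ => hs_conj (D i) M (τ B))
        (continuous_iff_continuous_norm.1 (hcomp i)).stronglyMeasurable hC
    rwa [Matrix.transpose_transpose] at this
  · exact fun i _ => integrable_of_continuous hA
  · exact fun i _ => integrable_of_continuous
      ((continuous_const.matrix_mul (hcomp i)).matrix_mul continuous_const)

theorem IsSelfSimilar.isGibbs (hD : ∀ i x, jac (S.ψ i) x = D i) {β : ℝ} (hβ : 0 < β)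
    {τ : NormedMeasure S.G (Mat d)} (h : S.IsSelfSimilar D β τ) {Q : Mat d} (hQ : Q.PosDef)
    (hQe : transfer D Q = β • Q) (h1 : hs d Q (τ univ) = 1) : S.IsGibbs β (fun _ => Q) τ := by
  have hfin := isFiniteMeasure_variation h.posSemidef
  exact
    { pos := hβ
      continuous := continuous_const
      posDef := fun _ => hQ
      eigen := fun x => by rw [ruelle_const hD, hQe]
      posSemidef := h.posSemidef
      dual_eigen := fun A hA _ => h.integral_ruelle hD hA
      normalised := by rw [VectorMeasure.integral_const, h1] }

theorem hsMeasure_const {τ : NormedMeasure S.G (Mat d)}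
    (h : ∀ B, MeasurableSet B → (τ B).PosSemidef) (Q : Mat d) (B : Set S.G) :
    S.hsMeasure (fun _ => Q) τ B = hs d Q (τ B) := by
  have hfin := isFiniteMeasure_variation h
  rw [hsMeasure, VectorMeasure.withDensity_apply (integrable_of_continuous continuous_const),
    VectorMeasure.setIntegral_const]

theorem IsSelfSimilar.transfer_univ {β : ℝ} {τ : NormedMeasure S.G (Mat d)}
    (h : S.IsSelfSimilar D β τ) : transfer (fun i => (D i)ᵀ) (τ univ) = β • τ univ := by
  rw [h.scaling univ .univ, transfer]
  simp

end IFS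

end Fractal

/-! ### Approximating functionals and their limits. -/

namespace Fractal

/-- A bounded sequence of positive functionals on continuous functions converges, along an
ultrafilter, to the integral with respect to a finite measure. -/
theorem exists_measure_tendsto_hyperfilter {X : Type*} [TopologicalSpace X] [CompactSpace X]
    [T2Space X] [MeasurableSpace X] [BorelSpace X] (L : ℕ → (X → ℝ) →ₗ[ℝ] ℝ)
    (hpos : ∀ l f, Continuous f → (∀ x, 0 ≤ f x) → 0 ≤ L l f)
    (hbd : ∀ f, Continuous f → ∃ C, ∀ l, |L l f| ≤ C) :
    ∃ μ : Measure X, IsFiniteMeasure μ ∧ ∀ f, Continuous f →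
      Filter.Tendsto (fun l => L l f) (Filter.hyperfilter ℕ) (nhds (∫ x, f x ∂μ)) := by
  have hlim : ∀ f : CompactlySupportedContinuousMap X ℝ, ∃ y,
      Filter.Tendsto (fun l => L l f) (Filter.hyperfilter ℕ) (nhds y) := by
    intro f
    obtain ⟨C, hC⟩ := hbd f f.continuous
    obtain ⟨y, -, hy⟩ := (isCompact_Icc (a := -C) (b := C)).ultrafilter_le_nhds
      ((Filter.hyperfilter ℕ).map fun l => L l f)
      (by
        rw [Ultrafilter.coe_map, Filter.le_principal_iff, Filter.mem_map]
        exact Filter.univ_mem' fun l => abs_le.1 (hC l))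
    exact ⟨y, hy⟩
  choose Λ hΛ using hlim
  -- One ultrafilter serves all f, so the limits are linear in f and Riesz's theorem applies.
  let Λₗ : CompactlySupportedContinuousMap X ℝ →ₗ[ℝ] ℝ :=
    { toFun := Λ
      map_add' := fun f g => tendsto_nhds_unique (hΛ (f + g)) (by
        simpa only [CompactlySupportedContinuousMap.coe_add, map_add] using (hΛ f).add (hΛ g))
      map_smul' := fun c f => tendsto_nhds_unique (hΛ (c • f)) (by
        simpa only [CompactlySupportedContinuousMap.coe_smul, map_smul, RingHom.id_apply] using (hΛ f).const_smul c) }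
  let Λp := PositiveLinearMap.mk₀ Λₗ fun f hf =>
    ge_of_tendsto (hΛ f) (Filter.Eventually.of_forall fun l => hpos l f f.continuous
      (CompactlySupportedContinuousMap.le_def.1 hf))
  refine ⟨RealRMK.rieszMeasure Λp, inferInstance, fun f hf => ?_⟩
  have h1 := hΛ ⟨⟨f, hf⟩, HasCompactSupport.of_compactSpace _⟩
  have h2 := RealRMK.integral_rieszMeasure Λp ⟨⟨f, hf⟩, HasCompactSupport.of_compactSpace _⟩
  exact Eq.subst (motive := fun y => Filter.Tendsto (fun l => L l f) (Filter.hyperfilter ℕ) (nhds y))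
    h2.symm h1

theorem abs_hs_le {d : ℕ} {M Q T : Mat d} {c : ℝ} (hT : T.PosSemidef)
    (h : ∀ v, |quad M v| ≤ c * quad Q v) : |hs d M T| ≤ c * hs d Q T := by
  have h1 := hs_mono (M := M) (N := c • Q) hT fun v => by
    rw [quad_smul]
    exact (abs_le.1 (h v)).2
  have h2 := hs_mono (M := -(c • Q)) (N := M) hT fun v => by
    rw [← neg_one_smul ℝ, quad_smul, quad_smul, neg_one_mul]
    exact (abs_le.1 (h v)).1
  simp only [map_neg, map_smul, FunLike.coe_smul, FunLike.coe_neg, Pi.neg_apply, Pi.smul_apply,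
    smul_eq_mul] at h1 h2
  exact abs_le.2 ⟨h2, h1⟩

/-- The (i, j) term equals v_i v_j / 2 times e_i⊗e_j + e_j⊗e_i. Thus v⊗v is a combination of
finitely many squares independent of v. -/
theorem sum_smul_vecMulVec_polarization {d : ℕ} (v : Fin d → ℝ) :
    ∑ i, ∑ j, (v i * v j / 4) • (Matrix.vecMulVec (Pi.single i 1 + Pi.single j 1)
        (Pi.single i 1 + Pi.single j 1) - Matrix.vecMulVec (Pi.single i 1 - Pi.single j 1)
        (Pi.single i 1 - Pi.single j 1)) = Matrix.vecMulVec v v := by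
  have h : ∀ i j : Fin d, (v i * v j / 4) • (Matrix.vecMulVec (Pi.single i 1 + Pi.single j 1)
        (Pi.single i 1 + Pi.single j 1) - Matrix.vecMulVec (Pi.single i 1 - Pi.single j 1)
        (Pi.single i 1 - Pi.single j 1)) =
      (v i * v j / 2) • (Matrix.vecMulVec (Pi.single i 1) (Pi.single j 1) : Mat d) +
      (v i * v j / 2) • (Matrix.vecMulVec (Pi.single j 1) (Pi.single i 1) : Mat d) := by
    intro i j
    ext k l
    simp only [Matrix.smul_apply, Matrix.sub_apply, Matrix.add_apply, Matrix.vecMulVec_apply,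
      Pi.add_apply, Pi.sub_apply, smul_eq_mul]
    ring
  simp only [h, Finset.sum_add_distrib]
  ext k l
  simp only [Matrix.add_apply, Matrix.sum_apply, Matrix.smul_apply, Matrix.vecMulVec_apply,
    Pi.single_apply, smul_eq_mul, mul_ite, mul_one, mul_zero,
    Finset.sum_ite_eq, Finset.mem_univ, if_true]
  simp [Finset.sum_ite_eq]
  ring

namespace IFS

variable {d n : ℕ} {S : IFS d n} {D : Fin n → Mat d}

variable (S) in
/-- The Ruelle operator, divided by `β`, as a linear map. -/
noncomputable def normRuelleₗ (β : ℝ) : (S.G → Mat d) →ₗ[ℝ] (S.G → Mat d) where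
  toFun := S.normRuelle β
  map_add' A B := by
    funext x
    simp [normRuelle, ruelle, Matrix.mul_add, Matrix.add_mul, Finset.sum_add_distrib]
  map_smul' c A := by
    funext x
    simp only [normRuelle, ruelle, Pi.smul_apply, Matrix.mul_smul, Matrix.smul_mul,
      ← Finset.smul_sum, RingHom.id_apply]
    rw [smul_comm]

variable (S) in
/-- The functional `A ↦ ((β⁻¹ L)^l A (x), T)_HS`. -/
noncomputable def approxFunctional (β : ℝ) (T : Mat d) (x : S.G) (l : ℕ) :
    (S.G → Mat d) →ₗ[ℝ] ℝ :=
  ((hs d).flip T).toLinearMap ∘ₗ LinearMap.proj x ∘ₗ (S.normRuelleₗ β ^ l)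

theorem approxFunctional_apply (β : ℝ) (T : Mat d) (x : S.G) (l : ℕ) (A : S.G → Mat d) :
    S.approxFunctional β T x l A = hs d ((S.normRuelle β)^[l] A x) T := by
  simp only [approxFunctional, LinearMap.comp_apply, Module.End.pow_apply]
  rfl

theorem quad_iterate_normRuelle_nonneg (hD : ∀ i x, jac (S.ψ i) x = D i) {β : ℝ} (hβ : 0 < β)
    {A : S.G → Mat d} (hA : ∀ x v, 0 ≤ quad (A x) v) (l : ℕ) (x : S.G) (v : Fin d → ℝ) :
    0 ≤ quad ((S.normRuelle β)^[l] A x) v := by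
  induction l generalizing x v with
  | zero => exact hA x v
  | succ l ih =>
    rw [Function.iterate_succ_apply', normRuelle, quad_smul, quad_ruelle hD]
    exact mul_nonneg (inv_nonneg.2 hβ.le) (Finset.sum_nonneg fun i _ => ih _ _)

theorem abs_quad_iterate_normRuelle_le (hD : ∀ i x, jac (S.ψ i) x = D i) {β : ℝ} (hβ : 0 < β)
    {Q : Mat d} (hQe : transfer D Q = β • Q) {A : S.G → Mat d} {C : ℝ}
    (hA : ∀ x v, |quad (A x) v| ≤ C * quad Q v) (l : ℕ) (x : S.G) (v : Fin d → ℝ) :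
    |quad ((S.normRuelle β)^[l] A x) v| ≤ C * quad Q v := by
  induction l generalizing x v with
  | zero => exact hA x v
  | succ l ih =>
    rw [Function.iterate_succ_apply', normRuelle, quad_smul, quad_ruelle hD, abs_mul,
      abs_of_pos (inv_pos.2 hβ), inv_mul_le_iff₀ hβ]
    refine (Finset.abs_sum_le_sum_abs _ _).trans
      ((Finset.sum_le_sum fun i _ => ih (S.branch i x) (D i *ᵥ v)).trans_eq ?_)
    rw [← Finset.mul_sum, ← quad_transfer, hQe, quad_smul]
    ring

theorem hs_iterate_normRuelle_const (hD : ∀ i x, jac (S.ψ i) x = D i) {β : ℝ} (hβ : 0 < β)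
    {T : Mat d} (hTe : transfer (fun i => (D i)ᵀ) T = β • T) (M : Mat d) (l : ℕ) (x : S.G) :
    hs d ((S.normRuelle β)^[l] (fun _ => M) x) T = hs d M T := by
  induction l generalizing M with
  | zero => rfl
  | succ l ih =>
    have : S.normRuelle β (fun _ => M) = fun _ => β⁻¹ • transfer D M := by
      funext x
      rw [normRuelle, ruelle_const hD]
    rw [Function.iterate_succ_apply, this, ih, map_smul, FunLike.coe_smul, Pi.smul_apply,
      hs_transfer, hTe, map_smul, smul_smul, inv_mul_cancel₀ hβ.ne', one_smul]

/-- The functionals `A ↦ ((β⁻¹ L)^l A (x), T)_HS` are asymptotically invariant. -/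
theorem tendsto_approxFunctional_sub (hd : 0 < d) (hD : ∀ i x, jac (S.ψ i) x = D i) {β : ℝ}
    (hβ : 0 < β) {Q T : Mat d} (hQ : Q.PosDef) (hQe : transfer D Q = β • Q) (hT : T.PosSemidef)
    (hTe : transfer (fun i => (D i)ᵀ) T = β • T) (x : S.G) {A : S.G → Mat d} (hA : Continuous A) :
    Filter.Tendsto (fun l => S.approxFunctional β T x l (S.normRuelle β A) -
      S.approxFunctional β T x l A) Filter.atTop (nhds 0) := by
  rw [Metric.tendsto_nhds]
  intro ε hε
  have hQT : 0 ≤ hs d Q T := hs_nonneg (posSemidef_iff_quad.1 hQ.posSemidef).2 hT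
  filter_upwards [eventually_oscLE hd hD hβ hA (continuous_const (y := Q)) (fun _ => hQ)
    (fun x => by rw [ruelle_const hD, hQe]) (s := ε / (hs d Q T + 1)) (by positivity)] with l hl
  rw [dist_zero_right, Real.norm_eq_abs, approxFunctional_apply, approxFunctional_apply,
    ← Function.iterate_succ_apply, Function.iterate_succ_apply']
  set B := (S.normRuelle β)^[l] A
  -- Expanding T through its eigenvalue equation turns the difference into oscillations of B between
  -- x and its images under the branches.
  have h1 : hs d (S.normRuelle β B x) T - hs d (B x) T =
      β⁻¹ * ∑ i, hs d (B (S.branch i x) - B x) (D i * T * (D i)ᵀ) := by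
    have hT' : T = β⁻¹ • ∑ i, D i * T * (D i)ᵀ := by
      have : ∑ i, D i * T * (D i)ᵀ = β • T := by simpa [transfer] using hTe
      rw [this, smul_smul, inv_mul_cancel₀ hβ.ne', one_smul]
    have h2 : hs d (B x) T = β⁻¹ * ∑ i, hs d (B x) (D i * T * (D i)ᵀ) := by
      conv_lhs => rw [hT']
      rw [map_smul, map_sum, smul_eq_mul]
    rw [h2, normRuelle, ruelle_eq hD, map_smul, FunLike.coe_smul, Pi.smul_apply, smul_eq_mul,
      ← mul_sub, map_sum, FunLike.coe_sum, Finset.sum_apply, ← Finset.sum_sub_distrib]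
    congr 1
    refine Finset.sum_congr rfl fun i _ => ?_
    rw [hs_conj, map_sub]
    rfl
  have h3 : ∑ i, hs d Q (D i * T * (D i)ᵀ) = β * hs d Q T := by
    have : ∑ i, D i * T * (D i)ᵀ = β • T := by simpa [transfer] using hTe
    rw [← map_sum, this, map_smul, smul_eq_mul]
  rw [h1, abs_mul, abs_of_pos (inv_pos.2 hβ), inv_mul_lt_iff₀ hβ]
  calc |∑ i, hs d (B (S.branch i x) - B x) (D i * T * (D i)ᵀ)|
      ≤ ∑ i, |hs d (B (S.branch i x) - B x) (D i * T * (D i)ᵀ)| :=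
        Finset.abs_sum_le_sum_abs _ _
    _ ≤ ∑ i, ε / (hs d Q T + 1) * hs d Q (D i * T * (D i)ᵀ) := Finset.sum_le_sum fun i _ =>
        abs_hs_le (posSemidef_conj' hT _) fun v => by
          rw [quad_sub]
          exact hl _ _ _
    _ = β * (ε * (hs d Q T / (hs d Q T + 1))) := by rw [← Finset.mul_sum, h3]; ring
    _ < β * ε := by
        refine mul_lt_mul_of_pos_left ?_ hβ
        refine mul_lt_of_lt_one_right hε ?_
        rw [div_lt_one (by positivity)]
        linarith

end IFS

end Fractal

/-! ### Construction of the self-similar matrix measure. -/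

namespace Fractal

/-- The matrix-valued measure with prescribed quadratic forms. -/
theorem exists_measure_of_quad {d : ℕ} {X : Type*} [MeasurableSpace X] [TopologicalSpace X]
    [BorelSpace X] [HasOuterApproxClosed X] (μ : (Fin d → ℝ) → Measure X)
    [∀ v, IsFiniteMeasure (μ v)]
    (h : ∀ v, ∀ f : BoundedContinuousFunction X ℝ, ∫ x, f x ∂(μ v) = ∑ i, ∑ j, v i * v j / 4 *
      (∫ x, f x ∂(μ (Pi.single i 1 + Pi.single j 1)) -
        ∫ x, f x ∂(μ (Pi.single i 1 - Pi.single j 1)))) :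
    ∃ τ : NormedMeasure X (Mat d), ∀ B, MeasurableSet B →
      (τ B).PosSemidef ∧ ∀ v, quad (τ B) v = (μ v).real B := by
  -- The factor 1/8 makes the quadratic form of `E i j` equal to v_i v_j / 4, as in polarization.
  let E : Fin d → Fin d → Mat d := fun i j =>
    (1 / 8 : ℝ) • (Matrix.single i j 1 + Matrix.single j i 1)
  let m : Fin d → Fin d → ℝ →L[ℝ] Mat d := fun i j => (ContinuousLinearMap.id ℝ ℝ).smulRight (E i j)
  let τ : NormedMeasure X (Mat d) := ∑ i, ∑ j,
    ((μ (Pi.single i 1 + Pi.single j 1)).toSignedMeasure -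
      (μ (Pi.single i 1 - Pi.single j 1)).toSignedMeasure).mapRange
        (m i j).toAddMonoidHom (m i j).continuous
  have hτ : ∀ B, MeasurableSet B → τ B = ∑ i, ∑ j,
      ((μ (Pi.single i 1 + Pi.single j 1)).real B - (μ (Pi.single i 1 - Pi.single j 1)).real B) •
        E i j := by
    intro B hB
    simp only [τ, FunLike.coe_sum, Finset.sum_apply]
    refine Finset.sum_congr rfl fun i _ => Finset.sum_congr rfl fun j _ => ?_
    change ((μ (Pi.single i 1 + Pi.single j 1)).toSignedMeasure -
      (μ (Pi.single i 1 - Pi.single j 1)).toSignedMeasure) B • E i j = _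
    rw [sub_apply, Measure.toSignedMeasure_apply_measurable hB, Measure.toSignedMeasure_apply_measurable hB]
  have hE : ∀ i j v, quad (E i j) v = v i * v j / 4 := by
    intro i j v
    simp only [E, quad_smul, quad_add]
    simp [quad, Matrix.single_mulVec, dotProduct, Function.update_apply]
    ring
  have hquad : ∀ B, MeasurableSet B → ∀ v, quad (τ B) v = (μ v).real B := by
    intro B hB v
    let p : Option ((Fin d × Fin d) × Bool) → Measure X := fun o => o.elim (μ v) fun q =>
      cond q.2 (μ (Pi.single q.1.1 1 + Pi.single q.1.2 1))
        (μ (Pi.single q.1.1 1 - Pi.single q.1.2 1))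
    have hp : ∀ o, IsFiniteMeasure (p o) := by
      rintro (_ | ⟨⟨i, j⟩, _ | _⟩) <;> simp only [p, Option.elim, cond] <;> infer_instance
    have key := sum_measureReal_eq_zero Finset.univ
      (fun o : Option ((Fin d × Fin d) × Bool) => o.elim (-1) fun q =>
        cond q.2 (v q.1.1 * v q.1.2 / 4) (-(v q.1.1 * v q.1.2 / 4))) p (fun f => by
      simp only [Fintype.sum_option, Fintype.sum_prod_type, Fintype.sum_bool, p, Option.elim, cond]
      rw [h v f, neg_one_mul, neg_add_eq_zero]
      exact Finset.sum_congr rfl fun i _ => Finset.sum_congr rfl fun j _ => by ring) B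
    simp only [Fintype.sum_option, Fintype.sum_prod_type, Fintype.sum_bool, p, Option.elim,
      cond] at key
    rw [neg_one_mul, neg_add_eq_zero] at key
    rw [hτ B hB, key]
    simp only [quad_sum, quad_smul, hE]
    exact Finset.sum_congr rfl fun i _ => Finset.sum_congr rfl fun j _ => by ring
  refine ⟨τ, fun B hB => ⟨posSemidef_iff_quad.2 ⟨?_, fun v => ?_⟩, hquad B hB⟩⟩
  · rw [hτ B hB]
    refine isSymm_sum _ fun i _ => isSymm_sum _ fun j _ => Matrix.IsSymm.smul ?_ _
    simp [E, Matrix.IsSymm, add_comm]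
  · rw [hquad B hB]
    exact measureReal_nonneg

namespace IFS

variable {d n : ℕ} {S : IFS d n} {D : Fin n → Mat d}

/-- For each v, the limit of f ↦ ((β⁻¹L)^l (f v⊗v)(x₀), T) is a scalar measure μ_v, meant to be (τ
v, v). Polarization assembles these into τ, and asymptotic invariance makes it self-similar. -/
theorem exists_isSelfSimilar (hd : 0 < d) (hD : ∀ i x, jac (S.ψ i) x = D i) {β : ℝ}
    (hβ : 0 < β) {Q T : Mat d} (hQ : Q.PosDef) (hQe : transfer D Q = β • Q) (hT : T.PosSemidef)
    (hTe : transfer (fun i => (D i)ᵀ) T = β • T) :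
    ∃ τ : NormedMeasure S.G (Mat d), S.IsSelfSimilar D β τ ∧ τ univ = T := by
  obtain ⟨x₀⟩ : Nonempty S.G := inferInstance
  let L : (Fin d → ℝ) → ℕ → (S.G → ℝ) →ₗ[ℝ] ℝ := fun v l =>
    S.approxFunctional β T x₀ l ∘ₗ
      { toFun := fun f x => f x • Matrix.vecMulVec v v
        map_add' := fun f g => by funext x; simp [add_smul]
        map_smul' := fun c f => by funext x; simp [smul_smul] }
  have hL : ∀ v l f, L v l f = S.approxFunctional β T x₀ l fun x => f x • Matrix.vecMulVec v v :=
    fun v l f => rfl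
  have hcont : ∀ v (f : S.G → ℝ), Continuous f →
      Continuous fun x => f x • Matrix.vecMulVec v v := fun v f hf =>
    hf.fun_smul (continuous_const (y := (Matrix.vecMulVec v v : Mat d)))
  have hex : ∀ v, ∃ μ : Measure S.G, IsFiniteMeasure μ ∧ ∀ f, Continuous f →
      Filter.Tendsto (fun l => L v l f) (Filter.hyperfilter ℕ) (nhds (∫ x, f x ∂μ)) := by
    intro v
    refine exists_measure_tendsto_hyperfilter (L v) (fun l f hf h0 => ?_) (fun f hf => ?_)
    · rw [hL, approxFunctional_apply]
      refine hs_nonneg (quad_iterate_normRuelle_nonneg hD hβ (fun x w => ?_) l x₀) hT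
      rw [quad_smul]
      exact mul_nonneg (h0 x) (quad_vecMulVec_nonneg v w)
    · obtain ⟨C, hC⟩ := exists_norm_le_of_continuous hf
      obtain ⟨ε, hε, hle⟩ := exists_smul_quad_le hd hQ (Matrix.vecMulVec v v)
      -- C bounds |f| and v⊗v ≤ ε⁻¹ Q, so f v⊗v lies between ∓C ε⁻¹ Q, a bound kept by every
      -- iterate.
      refine ⟨C * ε⁻¹ * hs d Q T, fun l => ?_⟩
      rw [hL, approxFunctional_apply]
      refine abs_hs_le hT (abs_quad_iterate_normRuelle_le hD hβ hQe (fun x w => ?_) l x₀)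
      have h1 := quad_vecMulVec_nonneg v w
      rw [quad_smul, abs_mul, abs_of_nonneg h1, mul_assoc]
      refine mul_le_mul (hC x) ?_ h1 ((norm_nonneg _).trans (hC x))
      rw [le_inv_mul_iff₀ hε]
      exact hle w
  choose μ hμf hμ using hex
  obtain ⟨τ, hτ⟩ := exists_measure_of_quad μ fun v f => by
    refine tendsto_nhds_unique (hμ v f f.continuous) ?_
    have h1 := tendsto_finsetSum Finset.univ fun i (_ : i ∈ (Finset.univ : Finset (Fin d))) =>
      tendsto_finsetSum Finset.univ fun j (_ : j ∈ (Finset.univ : Finset (Fin d))) =>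
        ((hμ (Pi.single i 1 + Pi.single j 1) f f.continuous).sub
          (hμ (Pi.single i 1 - Pi.single j 1) f f.continuous)).const_mul (v i * v j / 4)
    refine h1.congr fun l => ?_
    simp only [hL, ← map_sub, ← smul_eq_mul (_ / _), ← map_smul, ← map_sum]
    congr 1
    funext x
    simp only [Finset.sum_apply, Pi.smul_apply, Pi.sub_apply, ← smul_sub]
    rw [← sum_smul_vecMulVec_polarization v]
    simp only [Finset.smul_sum, smul_comm (f x)]
  have hweak : ∀ v (f : S.G → ℝ), Continuous f →
      β * ∫ x, f x ∂(μ v) = ∑ i, ∫ x, f (S.branch i x) ∂(μ ((D i)ᵀ *ᵥ v)) := by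
    intro v f hf
    have h1 : Filter.Tendsto (fun l => S.approxFunctional β T x₀ l
        (S.normRuelle β fun x => f x • Matrix.vecMulVec v v)) (Filter.hyperfilter ℕ)
        (nhds (β⁻¹ * ∑ i, ∫ x, f (S.branch i x) ∂(μ ((D i)ᵀ *ᵥ v)))) := by
      have h2 := (tendsto_finsetSum Finset.univ fun i (_ : i ∈ (Finset.univ : Finset (Fin n))) =>
        hμ ((D i)ᵀ *ᵥ v) _ (hf.comp (S.continuous_branch i))).const_mul β⁻¹
      refine h2.congr fun l => ?_
      have : S.normRuelle β (fun x => f x • Matrix.vecMulVec v v) = β⁻¹ • ∑ i, fun x =>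
          f (S.branch i x) • Matrix.vecMulVec ((D i)ᵀ *ᵥ v) ((D i)ᵀ *ᵥ v) := by
        funext x
        rw [normRuelle, ruelle_smul_vecMulVec hD, Pi.smul_apply, Finset.sum_apply]
      rw [this, map_smul, map_sum, smul_eq_mul]
      rfl
    have h3 := (tendsto_approxFunctional_sub hd hD hβ hQ hQe hT hTe x₀ (hcont v f hf)).mono_left
      Nat.hyperfilter_le_atTop
    have h4 := tendsto_nhds_unique (h1.sub (hμ v f hf)) h3
    rw [sub_eq_zero, inv_mul_eq_iff_eq_mul₀ hβ.ne'] at h4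
    exact h4.symm
  have hsymm : ∀ B, MeasurableSet B → (τ B).IsSymm := fun B hB =>
    (posSemidef_iff_quad.1 (hτ B hB).1).1
  refine ⟨τ, ⟨fun B hB => (hτ B hB).1, fun B hB => ?_⟩, ?_⟩
  · refine eq_of_quad_eq ((hsymm B hB).smul β)
      (isSymm_sum _ fun i _ => isSymm_conj' (hsymm _ (measurable_branch i hB)) _) fun v => ?_
    rw [quad_smul, quad_sum, (hτ B hB).2, measureReal_selfSimilar μ (hweak v) hB]
    refine Finset.sum_congr rfl fun i _ => ?_
    rw [← (hτ _ (measurable_branch i hB)).2]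
    simpa using (quad_conj (τ (S.branch i ⁻¹' B)) (D i)ᵀ v).symm
  · refine eq_of_quad_eq (hsymm _ .univ) (posSemidef_iff_quad.1 hT).1 fun v => ?_
    rw [(hτ _ .univ).2]
    -- For f = 1 the functionals do not depend on l, because T is an eigenvector of the dual.
    refine tendsto_nhds_unique (f := fun l => L v l fun _ => 1) (l := Filter.hyperfilter ℕ) ?_ ?_
    · simpa using hμ v (fun _ => 1) continuous_const
    · refine tendsto_const_nhds.congr fun l => ?_
      simp only [hL, one_smul]
      rw [approxFunctional_apply, hs_iterate_normRuelle_const hD hβ hTe, hs_vecMulVec]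

end IFS

end Fractal

/-! ### Cells, codings and post-critical finiteness. -/

namespace Fractal

namespace IFS

variable {d n : ℕ} (S : IFS d n)

/-- The cell of a word, as a subset of the attractor. -/
def subcell (w : List (Fin n)) : Set S.G := Subtype.val ⁻¹' S.cell w

theorem subcell_nil : S.subcell [] = univ := by
  ext x
  simp [subcell, cell, wordMap]

theorem subcell_cons (i : Fin n) (w : List (Fin n)) :
    S.subcell (i :: w) = S.branch i '' S.subcell w := by
  have hsub : ∀ w : List (Fin n), S.cell w ⊆ S.G := by
    intro w
    induction w with
    | nil => simp [cell, wordMap]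
    | cons i w ih =>
      rw [cell, wordMap, image_comp]
      rintro _ ⟨y, hy, rfl⟩
      exact S.mapsTo i (ih hy)
  ext x
  simp only [subcell, mem_preimage, cell, wordMap, image_comp]
  constructor
  · rintro ⟨y, hy, hxy⟩
    exact ⟨⟨y, hsub w hy⟩, hy, Subtype.ext hxy⟩
  · rintro ⟨y, hy, rfl⟩
    exact ⟨y, hy, rfl⟩

theorem isClosed_subcell (w : List (Fin n)) : IsClosed (S.subcell w) := by
  suffices IsCompact (S.subcell w) from this.isClosed
  induction w with
  | nil => rw [subcell_nil]; exact isCompact_univ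
  | cons i w ih => rw [subcell_cons]; exact ih.image (S.continuous_branch i)

theorem exists_branch_eq (x : S.G) : ∃ i y, S.branch i y = x := by
  obtain ⟨i, y, hy, hxy⟩ := mem_iUnion.1 (S.selfSimilar.subset x.2)
  exact ⟨i, ⟨y, hy⟩, Subtype.ext hxy⟩

theorem mem_overlap_of_branch_eq {i j : Fin n} (hij : i ≠ j) {y z : S.G}
    (h : S.branch i y = S.branch j z) : (S.branch i y : Euc d) ∈ S.overlap := by
  simp only [overlap, mem_iUnion]
  refine ⟨i, j, hij, ⟨y, y.2, rfl⟩, ?_⟩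
  rw [h]
  exact ⟨z, z.2, rfl⟩

theorem codes_iff_subcell (c : ℕ → Fin n) (x : S.G) :
    S.Codes c x ↔ ∀ l : ℕ, x ∈ S.subcell (List.ofFn fun k : Fin l => c k) := by
  constructor
  · rintro h (_ | l)
    · simp [subcell_nil]
    · exact h l
  · exact fun h l => h (l + 1)

/-- Each l gives a preimage of x in the shifted cell; injectivity of the branch makes all these
preimages one point z. -/
theorem codes_iff_exists (c : ℕ → Fin n) (x : S.G) :
    S.Codes c x ↔ ∃ z, x = S.branch (c 0) z ∧ S.Codes (fun k => c (k + 1)) z := by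
  have hcons : ∀ l, (List.ofFn fun k : Fin (l + 1) => c k) =
      c 0 :: List.ofFn fun k : Fin l => c (k + 1) := fun l => by
    rw [List.ofFn_succ]
    rfl
  constructor
  · intro h
    rw [codes_iff_subcell] at h
    have h' : ∀ l, ∃ z ∈ S.subcell (List.ofFn fun k : Fin l => c (k + 1)),
        S.branch (c 0) z = x := fun l => by
      have := h (l + 1)
      rwa [hcons, subcell_cons] at this
    obtain ⟨z, -, hz⟩ := h' 0
    refine ⟨z, hz.symm, (S.codes_iff_subcell _ _).2 fun l => ?_⟩
    obtain ⟨z', hz', hzz'⟩ := h' l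
    rwa [← S.injective_branch (c 0) (hzz'.trans hz.symm)]
  · rintro ⟨z, rfl, hz⟩ l
    change S.branch (c 0) z ∈ S.subcell _
    rw [hcons, subcell_cons]
    exact ⟨z, (S.codes_iff_subcell _ _).1 hz l, rfl⟩

theorem exists_codes (x : S.G) : ∃ c, S.Codes c x := by
  choose I Z hZ using S.exists_branch_eq
  refine ⟨fun k => I (Z^[k] x), (S.codes_iff_subcell _ _).2 fun l => ?_⟩
  induction l generalizing x with
  | zero => simp [subcell_nil]
  | succ l ih =>
    rw [List.ofFn_succ, subcell_cons]
    exact ⟨Z x, ih (Z x), hZ x⟩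

/-- The sequence with first letter `i`, followed by `c`. -/
def seqCons (i : Fin n) (c : ℕ → Fin n) : ℕ → Fin n
  | 0 => i
  | k + 1 => c k

theorem seqCons_shift (c : ℕ → Fin n) : seqCons (c 0) (fun k => c (k + 1)) = c := by
  funext k
  cases k <;> rfl

theorem codes_seqCons {i : Fin n} {c : ℕ → Fin n} {z : S.G} (h : S.Codes c z) :
    S.Codes (seqCons i c) (S.branch i z) := (S.codes_iff_exists _ _).2 ⟨z, rfl, h⟩

variable {S}

theorem PostCriticallyFinite.finite_overlapCodings (h : S.PostCriticallyFinite) :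
    S.overlapCodings.Finite := by
  have h0 : ((fun (x : ℕ → Fin n) (k : ℕ) => x (k + (0 + 1))) '' S.overlapCodings).Finite :=
    Set.Finite.subset h (subset_iUnion (fun j : ℕ =>
      (fun (x : ℕ → Fin n) (k : ℕ) => x (k + (j + 1))) '' S.overlapCodings) 0)
  refine Set.Finite.subset (Set.finite_iUnion fun i : Fin n => h0.image (seqCons i)) fun c hc => ?_
  exact mem_iUnion.2 ⟨c 0, _, ⟨c, hc, rfl⟩, seqCons_shift c⟩

/-- In a post-critically finite fractal, every point has finitely many codings. -/
theorem PostCriticallyFinite.finite_codings (h : S.PostCriticallyFinite) (x : S.G) :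
    {c | S.Codes c x}.Finite := by
  by_contra hinf
  -- A point with infinitely many codings is no overlap point, so all its codings share their first
  -- letter, and the shifted point again has infinitely many. Inductively all letters agree, which
  -- leaves at most one coding.
  have key : ∀ (k : ℕ) (x : S.G), ¬ {c | S.Codes c x}.Finite → ∀ c c', S.Codes c x →
      S.Codes c' x → c k = c' k := by
    intro k
    induction k with
    | zero =>
      intro x hx c c' hc hc'
      by_contra hne
      obtain ⟨z, hz, -⟩ := (S.codes_iff_exists _ _).1 hc
      obtain ⟨z', hz', -⟩ := (S.codes_iff_exists _ _).1 hc'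
      have hov := S.mem_overlap_of_branch_eq hne (hz.symm.trans hz')
      rw [← hz] at hov
      exact hx (h.finite_overlapCodings.subset fun c hc => ⟨x, hov, hc⟩)
    | succ k ih =>
      intro x hx c c' hc hc'
      have h0 : ∀ c c', S.Codes c x → S.Codes c' x → c 0 = c' 0 := by
        intro c c' hc hc'
        by_contra hne
        obtain ⟨z, hz, -⟩ := (S.codes_iff_exists _ _).1 hc
        obtain ⟨z', hz', -⟩ := (S.codes_iff_exists _ _).1 hc'
        have hov := S.mem_overlap_of_branch_eq hne (hz.symm.trans hz')
        rw [← hz] at hov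
        exact hx (h.finite_overlapCodings.subset fun c hc => ⟨x, hov, hc⟩)
      obtain ⟨z, hz, hcz⟩ := (S.codes_iff_exists _ _).1 hc
      have hz' : ∀ c', S.Codes c' x → S.Codes (fun k => c' (k + 1)) z := by
        intro c' hc'
        obtain ⟨z', hz', hcz'⟩ := (S.codes_iff_exists _ _).1 hc'
        rw [h0 c' c hc' hc, hz] at hz'
        rwa [S.injective_branch _ hz']
      refine ih z (fun hfin => hx ?_) _ _ hcz (hz' c' hc')
      refine (hfin.image (seqCons (c 0))).subset fun c' hc' =>
        ⟨fun k => c' (k + 1), hz' c' hc', ?_⟩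
      rw [h0 c c' hc hc', seqCons_shift]
  refine hinf (Set.Subsingleton.finite fun c hc c' hc' => ?_)
  funext k
  exact key k x hinf c c' hc hc'

variable (S) in
/-- The codings of the points of a set. -/
def codings (B : Set S.G) : Set (ℕ → Fin n) := {c | ∃ x ∈ B, S.Codes c x}

/-- Prefixing the letter i embeds the disjoint union of the codings of the preimages into the
codings of B. -/
theorem sum_ncard_codings_le {B : Set S.G} (hB : (S.codings B).Finite) :
    (∀ i, (S.codings (S.branch i ⁻¹' B)).Finite) ∧
      ∑ i, (S.codings (S.branch i ⁻¹' B)).ncard ≤ (S.codings B).ncard := by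
  have hmem : ∀ i c, c ∈ S.codings (S.branch i ⁻¹' B) → seqCons i c ∈ S.codings B := by
    rintro i c ⟨x, hx, hc⟩
    exact ⟨_, hx, S.codes_seqCons hc⟩
  have hinj : ∀ i i' (c c' : ℕ → Fin n), seqCons i c = seqCons i' c' → i = i' ∧ c = c' :=
    fun i i' c c' h => ⟨congrFun h 0, funext fun k => congrFun h (k + 1)⟩
  have hfin : ∀ i, (S.codings (S.branch i ⁻¹' B)).Finite := fun i =>
    Set.Finite.of_injOn (fun c hc => hmem i c hc) (fun c _ c' _ h => (hinj _ _ _ _ h).2) hB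
  refine ⟨hfin, ?_⟩
  have : Finite (S.codings B) := hB
  have : ∀ i, Finite (S.codings (S.branch i ⁻¹' B)) := fun i => hfin i
  simp only [← Nat.card_coe_set_eq]
  rw [← Nat.card_sigma]
  refine Nat.card_le_card_of_injective
    (fun p : Σ i, S.codings (S.branch i ⁻¹' B) => (⟨_, hmem p.1 p.2 p.2.2⟩ : S.codings B)) ?_
  rintro ⟨i, c⟩ ⟨i', c'⟩ h
  obtain ⟨rfl, h'⟩ := hinj _ _ _ _ (congrArg Subtype.val h)
  exact Sigma.ext rfl (heq_of_eq (Subtype.ext h'))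

/-- A measure which is contracted by the branches gives no mass to sets with finitely many
codings. -/
theorem measureReal_eq_zero_of_contraction {μ : Measure S.G} [IsFiniteMeasure μ] {θ : ℝ}
    (hθ0 : 0 ≤ θ) (hθ1 : θ < 1)
    (h : ∀ B, MeasurableSet B → μ.real B ≤ θ * ∑ i, μ.real (S.branch i ⁻¹' B))
    {B : Set S.G} (hB : MeasurableSet B) (hfin : (S.codings B).Finite) : μ.real B = 0 := by
  -- Each pull-back gains a factor θ while the total number of codings does not grow.
  have key : ∀ (l : ℕ) (B : Set S.G), MeasurableSet B → (S.codings B).Finite →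
      μ.real B ≤ (S.codings B).ncard * (θ ^ l * μ.real univ) := by
    intro l
    induction l with
    | zero =>
      intro B hB hfin
      rcases B.eq_empty_or_nonempty with rfl | ⟨x, hx⟩
      · simp only [measureReal_empty]
        positivity
      · obtain ⟨c, hc⟩ := S.exists_codes x
        have h1 : 1 ≤ (S.codings B).ncard := (Set.ncard_pos hfin).2 ⟨c, x, hx, hc⟩
        have h2 : μ.real B ≤ μ.real univ := measureReal_mono (subset_univ B)
        have h3 : (1 : ℝ) ≤ (S.codings B).ncard := by exact_mod_cast h1
        have h4 : 0 ≤ μ.real univ := measureReal_nonneg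
        rw [pow_zero, one_mul]
        nlinarith
    | succ l ih =>
      intro B hB hfin
      obtain ⟨hf, hle⟩ := sum_ncard_codings_le hfin
      have hle' : ∑ i, ((S.codings (S.branch i ⁻¹' B)).ncard : ℝ) ≤ (S.codings B).ncard := by
        exact_mod_cast hle
      calc μ.real B ≤ θ * ∑ i, μ.real (S.branch i ⁻¹' B) := h B hB
        _ ≤ θ * ∑ i, (S.codings (S.branch i ⁻¹' B)).ncard * (θ ^ l * μ.real univ) := by
            refine mul_le_mul_of_nonneg_left (Finset.sum_le_sum fun i _ => ?_) hθ0
            exact ih _ (measurable_branch i hB) (hf i)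
        _ = (∑ i, ((S.codings (S.branch i ⁻¹' B)).ncard : ℝ)) * (θ ^ (l + 1) * μ.real univ) := by
            rw [← Finset.sum_mul]
            ring
        _ ≤ (S.codings B).ncard * (θ ^ (l + 1) * μ.real univ) :=
            mul_le_mul_of_nonneg_right hle' (by positivity)
  have hlim : Filter.Tendsto (fun l : ℕ => (S.codings B).ncard * (θ ^ l * μ.real univ))
      Filter.atTop (nhds 0) := by
    simpa using ((tendsto_pow_atTop_nhds_zero_of_lt_one hθ0 hθ1).mul_const (μ.real univ)).const_mul
      ((S.codings B).ncard : ℝ)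
  exact le_antisymm (ge_of_tendsto' hlim fun l => key l B hB hfin) measureReal_nonneg

theorem PostCriticallyFinite.finite_codings_of_finite (h : S.PostCriticallyFinite) {B : Set S.G}
    (hB : B.Finite) : (S.codings B).Finite :=
  (hB.biUnion fun x _ => h.finite_codings x).subset fun _ ⟨x, hx, hc⟩ =>
    mem_iUnion₂.2 ⟨x, hx, hc⟩

/-! ### Measures are determined by their values on cells. -/

theorem FiniteOverlap.finite_inter (h : S.FiniteOverlap) {i j : Fin n} (hij : i ≠ j) :
    (range (S.branch i) ∩ range (S.branch j)).Finite := by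
  refine Set.Finite.of_injOn (f := Subtype.val) (t := S.ψ i '' S.G ∩ S.ψ j '' S.G) ?_
    Subtype.val_injective.injOn (h i j hij)
  rintro _ ⟨⟨y, rfl⟩, z, hz⟩
  refine ⟨⟨y, y.2, rfl⟩, ?_⟩
  rw [← hz]
  exact ⟨z, z.2, rfl⟩

theorem FiniteOverlap.finite_subcell_inter (h : S.FiniteOverlap) :
    ∀ {w w' : List (Fin n)}, w.length = w'.length → w ≠ w' →
      (S.subcell w ∩ S.subcell w').Finite := by
  intro w
  induction w with
  | nil =>
    intro w' hl hne
    exact absurd (List.eq_nil_of_length_eq_zero hl.symm).symm hne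
  | cons i w ih =>
    rintro (_ | ⟨j, w'⟩) hl hne
    · simp at hl
    · rw [subcell_cons, subcell_cons]
      rcases eq_or_ne i j with rfl | hij
      · rw [← image_inter (S.injective_branch i)]
        exact (ih (by simpa using hl) (by simpa using hne)).image _
      · exact (h.finite_inter hij).subset
          (inter_subset_inter (image_subset_range _ _) (image_subset_range _ _))

theorem dist_le_of_mem_subcell {η : ℝ} (hη : 0 ≤ η)
    (hcontr : ∀ i x y, dist (S.branch i x) (S.branch i y) ≤ η * dist x y) (w : List (Fin n))
    {x y : S.G} (hx : x ∈ S.subcell w) (hy : y ∈ S.subcell w) :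
    dist x y ≤ η ^ w.length * Metric.diam (univ : Set S.G) := by
  induction w generalizing x y with
  | nil =>
    simpa using Metric.dist_le_diam_of_mem isCompact_univ.isBounded (mem_univ x) (mem_univ y)
  | cons i w ih =>
    rw [subcell_cons] at hx hy
    obtain ⟨x, hx, rfl⟩ := hx
    obtain ⟨y, hy, rfl⟩ := hy
    refine (hcontr i x y).trans ?_
    rw [List.length_cons, pow_succ', mul_assoc]
    exact mul_le_mul_of_nonneg_left (ih hx hy) hη

/-- Finite measures which agree on cells, and for which cells of the same generation are almost
disjoint, are equal. -/
theorem measure_eq_of_subcell {p q : Measure S.G} [IsFiniteMeasure p] [IsFiniteMeasure q]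
    (h : ∀ w, w ≠ [] → p (S.subcell w) = q (S.subcell w))
    (hp : ∀ w w' : List (Fin n), w.length = w'.length → w ≠ w' →
      p (S.subcell w ∩ S.subcell w') = 0)
    (hq : ∀ w w' : List (Fin n), w.length = w'.length → w ≠ w' →
      q (S.subcell w ∩ S.subcell w') = 0) : p = q := by
  classical
  obtain ⟨η, hη, hη1, hcontr⟩ := S.exists_dist_branch_le
  let c : ∀ l, (Fin l → Fin n) → Set S.G := fun l w => S.subcell (List.ofFn w)
  let W : Set S.G → ∀ l, Finset (Fin l → Fin n) := fun F l =>
    Finset.univ.filter fun w => (c l w ∩ F).Nonempty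
  -- The union of the cells of generation l that meet F contains F and lies in a thickening of F
  -- whose radius tends to zero, so its mass tends to that of F when F is closed.
  let U : Set S.G → ℕ → Set S.G := fun F l => ⋃ w ∈ W F l, c l w
  have hU : ∀ (m : Measure S.G), (∀ w w' : List (Fin n), w.length = w'.length → w ≠ w' →
      m (S.subcell w ∩ S.subcell w') = 0) → ∀ F l, m (U F l) = ∑ w ∈ W F l, m (c l w) := by
    intro m hm F l
    refine measure_biUnion_finset₀ (fun w _ w' _ hne => ?_)
      fun w _ => (S.isClosed_subcell _).measurableSet.nullMeasurableSet
    exact hm _ _ (by simp) fun h => hne (List.ofFn_injective h)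
  have hlim : ∀ (m : Measure S.G) [IsFiniteMeasure m] (F : Set S.G), IsClosed F →
      Filter.Tendsto (fun l => m (U F l)) Filter.atTop (nhds (m F)) := by
    intro m _ F hF
    have hr : Filter.Tendsto (fun l => η ^ l * Metric.diam (univ : Set S.G)) Filter.atTop
        (nhds 0) := by
      simpa using (tendsto_pow_atTop_nhds_zero_of_lt_one hη hη1).mul_const
        (Metric.diam (univ : Set S.G))
    refine tendsto_of_tendsto_of_tendsto_of_le_of_le tendsto_const_nhds
      ((tendsto_measure_cthickening_of_isClosed ⟨1, one_pos, measure_ne_top _ _⟩ hF).comp hr)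
      (fun l => measure_mono fun x hx => ?_) (fun l => measure_mono fun x hx => ?_)
    · obtain ⟨s, hs⟩ := S.exists_codes x
      have hs' := (S.codes_iff_subcell s x).1 hs l
      exact mem_iUnion₂.2 ⟨fun k => s k, by simpa [W] using ⟨x, hs', hx⟩, hs'⟩
    · obtain ⟨w, hw, hxw⟩ := mem_iUnion₂.1 hx
      obtain ⟨y, hyw, hy⟩ := (Finset.mem_filter.1 hw).2
      refine Metric.mem_cthickening_of_dist_le x y _ F hy ?_
      simpa using dist_le_of_mem_subcell hη hcontr _ hxw hyw
  have hclosed : ∀ F, IsClosed F → p F = q F := by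
    intro F hF
    refine tendsto_nhds_unique ((hlim p F hF).congr' ?_) (hlim q F hF)
    filter_upwards [Filter.eventually_ge_atTop 1] with l hl
    rw [hU p hp, hU q hq]
    refine Finset.sum_congr rfl fun w _ => h _ fun h0 => ?_
    have := congrArg List.length h0
    simp at this
    omega
  exact ext_of_generate_finite {F | IsClosed F} (by
      rw [BorelSpace.measurable_eq (α := S.G), borel_eq_generateFrom_isClosed]) isPiSystem_isClosed
    hclosed (hclosed univ isClosed_univ)

end IFS

end Fractal

/-! ### Strict contraction, absence of atoms and Kusuoka's formula. -/

namespace Fractal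

variable {d n : ℕ}

/-- If all matrices are injective and there are at least two of them, each contracts the
eigenvector strictly, after normalisation. -/
theorem exists_quad_mulVec_le (hd : 0 < d) {D : Fin n → Mat d}
    (hinj : ∀ i (v : Fin d → ℝ), D i *ᵥ v = 0 → v = 0) (hn : Nontrivial (Fin n)) {β : ℝ}
    (hβ : 0 < β) {Q : Mat d} (hQ : Q.PosDef) (hQe : transfer D Q = β • Q) :
    ∃ θ : ℝ, 0 ≤ θ ∧ θ < 1 ∧ ∀ i v, quad Q (D i *ᵥ v) ≤ quad ((θ * β) • Q) v := by
  have hQ' := posDef_iff_quad.1 hQ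
  have hQ0 := (posSemidef_iff_quad.1 hQ.posSemidef).2
  have hconj : ∀ i, ((D i)ᵀ * Q * D i).PosDef := fun i =>
    posDef_iff_quad.2 ⟨isSymm_conj hQ'.1 _, fun v hv => by
      rw [quad_conj]
      exact hQ'.2 _ fun h0 => hv (hinj i v h0)⟩
  choose ε hε hεQ using fun i => exists_smul_quad_le hd (hconj i) Q
  obtain ⟨m, hm⟩ := Finite.exists_min ε
  refine ⟨max 0 (1 - ε m / β), le_max_left _ _, max_lt one_pos ?_, fun i v => ?_⟩
  · have := div_pos (hε m) hβ
    linarith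
  -- In βQ = ∑ ᵗD_k Q D_k, the term of a second index j is at least ε m Q, so the term of i is at
  -- most (β - ε m) Q; this is the source of θ.
  obtain ⟨j, hj⟩ := exists_ne i
  have h1 : quad Q (D i *ᵥ v) + quad Q (D j *ᵥ v) ≤ β * quad Q v := by
    rw [← quad_smul, ← hQe, quad_transfer, ← Finset.sum_pair (f := fun k => quad Q (D k *ᵥ v)) hj.symm]
    exact Finset.sum_le_sum_of_subset_of_nonneg (Finset.subset_univ _) fun _ _ _ => hQ0 _
  have h2 : ε m * quad Q v ≤ quad Q (D j *ᵥ v) :=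
    (mul_le_mul_of_nonneg_right (hm j) (hQ0 v)).trans ((hεQ j v).trans (quad_conj _ _ _).le)
  have h3 : (1 - ε m / β) * (β * quad Q v) ≤ max 0 (1 - ε m / β) * (β * quad Q v) :=
    mul_le_mul_of_nonneg_right (le_max_right _ _) (mul_nonneg hβ.le (hQ0 v))
  have h4 : (1 - ε m / β) * (β * quad Q v) = β * quad Q v - ε m * quad Q v := by
    field_simp
  rw [quad_smul, mul_assoc]
  linarith

theorem hs_smul_left (c : ℝ) (A B : Mat d) : hs d (c • A) B = c * hs d A B := by
  simp

theorem hs_smul_right (c : ℝ) (A B : Mat d) : hs d A (c • B) = c * hs d A B := by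
  simp

theorem hs_mul_transpose_le {C Q T : Mat d} {c : ℝ} (h : ∀ v, quad Q (C *ᵥ v) ≤ quad (c • Q) v)
    (hT : T.PosSemidef) : hs d Q (C * T * Cᵀ) ≤ c * hs d Q T := by
  rw [← hs_conj, ← hs_smul_left]
  exact hs_mono hT fun v => (quad_conj _ _ _).trans_le (h v)

theorem hs_word_le {D : Fin n → Mat d} {Q T : Mat d} {c : ℝ} (hc : 0 ≤ c)
    (h : ∀ i v, quad Q (D i *ᵥ v) ≤ quad (c • Q) v) (hT : T.PosSemidef) (w : List (Fin n)) :
    hs d Q ((w.map D).prod * T * ((w.map D).prod)ᵀ) ≤ c ^ w.length * hs d Q T := by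
  induction w with
  | nil => simp
  | cons i w ih =>
    have := hs_mul_transpose_le (h i) (posSemidef_conj' hT (w.map D).prod)
    simp only [List.map_cons, List.prod_cons, Matrix.transpose_mul, List.length_cons, pow_succ',
      Matrix.mul_assoc] at this ih ⊢
    exact this.trans ((mul_le_mul_of_nonneg_left ih hc).trans_eq (mul_assoc _ _ _).symm)

namespace IFS

variable {S : IFS d n} {D : Fin n → Mat d} {β θ : ℝ} {Q : Mat d} {τ : NormedMeasure S.G (Mat d)}

/-- Self-similar measures on post-critically finite fractals have no atoms. -/
theorem IsSelfSimilar.eq_zero_of_finite (h : S.IsSelfSimilar D β τ)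
    (hpcf : S.PostCriticallyFinite) (hβ : 0 < β) (hQ : Q.PosDef) (hθ0 : 0 ≤ θ) (hθ1 : θ < 1)
    (hθ : ∀ i v, quad Q (D i *ᵥ v) ≤ quad ((θ * β) • Q) v) {B : Set S.G} (hB : B.Finite) :
    τ B = 0 := by
  obtain ⟨μ, hμ, hμτ⟩ := exists_measure_hs h.posSemidef (posSemidef_iff_quad.1 hQ.posSemidef).2
  have hμ0 : μ.real B = 0 := by
    refine measureReal_eq_zero_of_contraction hθ0 hθ1 (fun B hB => ?_) hB.measurableSet
      (hpcf.finite_codings_of_finite hB)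
    have h1 : β * μ.real B ≤ β * (θ * ∑ i, μ.real (S.branch i ⁻¹' B)) := by
      rw [← hμτ B hB, ← hs_smul_right, h.scaling B hB, map_sum, ← mul_assoc, Finset.mul_sum]
      refine Finset.sum_le_sum fun i _ => ?_
      rw [← hμτ _ (measurable_branch i hB), mul_comm β]
      exact hs_mul_transpose_le (hθ i) (h.posSemidef _ (measurable_branch i hB))
    exact le_of_mul_le_mul_left h1 hβ
  by_contra h0
  have := hs_pos hQ (h.posSemidef B hB.measurableSet) h0
  rw [hμτ B hB.measurableSet, hμ0] at this
  exact this.false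

/-- In the scaling relation for the cell i w, branch i contributes the cell w. For j ≠ i, branch j
embeds the preimage into a finite overlap, so it is null. With a single letter no such j exists, and
null finite sets are not needed. -/
theorem IsSelfSimilar.apply_subcell (h : S.IsSelfSimilar D β τ) (hov : S.FiniteOverlap)
    (hβ : 0 < β) (hfin : Nontrivial (Fin n) → ∀ B : Set S.G, B.Finite → τ B = 0)
    (w : List (Fin n)) :
    τ (S.subcell w) =
      (β ^ w.length)⁻¹ • ((w.map D).prod * τ univ * ((w.map D).prod)ᵀ) := by
  induction w with
  | nil => simp [subcell_nil]
  | cons i w ih =>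
    have h1 := h.scaling _ (S.isClosed_subcell (i :: w)).measurableSet
    rw [Finset.sum_eq_single i, subcell_cons, preimage_image_eq _ (S.injective_branch i), ih] at h1
    · rw [← subcell_cons] at h1
      rw [← inv_smul_smul₀ hβ.ne' (τ (S.subcell (i :: w))), h1]
      simp only [Matrix.mul_smul, Matrix.smul_mul, smul_smul, List.length_cons, pow_succ',
        mul_inv, List.map_cons, List.prod_cons, Matrix.transpose_mul, Matrix.mul_assoc]
    · intro j _ hj
      rw [hfin ⟨j, i, hj⟩]
      · simp
      · rw [subcell_cons]
        refine Set.Finite.of_injOn (f := S.branch j) (fun y hy => ?_)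
          (S.injective_branch j).injOn (hov.finite_inter hj)
        exact ⟨⟨y, rfl⟩, image_subset_range _ _ hy⟩
    · simp

/-- A measure whose cells have masses tending to zero has no atoms. -/
theorem measure_finite_eq_zero {κ : Measure S.G} [IsFiniteMeasure κ] {c : ℝ} (hθ0 : 0 ≤ θ)
    (hθ1 : θ < 1) (h : ∀ w, w ≠ [] → κ.real (S.subcell w) ≤ θ ^ w.length * c) {B : Set S.G}
    (hB : B.Finite) : κ B = 0 := by
  rw [← biUnion_of_singleton B, measure_biUnion_null_iff hB.countable]
  intro x _
  obtain ⟨s, hs⟩ := S.exists_codes x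
  rw [codes_iff_subcell] at hs
  have hlim : Filter.Tendsto (fun l : ℕ => θ ^ (l + 1) * c) Filter.atTop (nhds 0) := by
    simpa using ((Filter.tendsto_add_atTop_iff_nat 1).2
      (tendsto_pow_atTop_nhds_zero_of_lt_one hθ0 hθ1)).mul_const c
  refine (measureReal_eq_zero_iff).1 (le_antisymm (ge_of_tendsto' hlim fun l => ?_)
    measureReal_nonneg)
  refine (measureReal_mono (singleton_subset_iff.2 (hs (l + 1)))).trans ?_
  simpa using h (List.ofFn fun k : Fin (l + 1) => s k) (by simp)

/-- Measures given on cells by Kusuoka's formula are determined by these values. -/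
theorem measureReal_eq_mul_of_subcell {κ μ : Measure S.G} [IsFiniteMeasure κ] [IsFiniteMeasure μ]
    (hov : S.FiniteOverlap) {T : Mat d} (hT : T.PosSemidef) (hβ : 0 < β) {a : ℝ} (ha : 0 < a)
    (hθ : Nontrivial (Fin n) →
      ∃ θ : ℝ, 0 ≤ θ ∧ θ < 1 ∧ ∀ i v, quad Q (D i *ᵥ v) ≤ quad ((θ * β) • Q) v)
    (hμ : ∀ w, μ.real (S.subcell w) =
      (β ^ w.length)⁻¹ * hs d Q ((w.map D).prod * T * ((w.map D).prod)ᵀ))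
    (hκ : ∀ w, w ≠ [] → κ.real (S.subcell w) = a * μ.real (S.subcell w)) (B : Set S.G) :
    κ.real B = a * μ.real B := by
  have hle : ∀ θ : ℝ, 0 ≤ θ → (∀ i v, quad Q (D i *ᵥ v) ≤ quad ((θ * β) • Q) v) → ∀ w,
      μ.real (S.subcell w) ≤ θ ^ w.length * hs d Q T := by
    intro θ hθ0 hθ w
    rw [hμ, inv_mul_le_iff₀ (by positivity)]
    refine (hs_word_le (by positivity) hθ hT w).trans_eq ?_
    rw [mul_pow]
    ring
  let μ' : Measure S.G := a.toNNReal • μ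
  have hμ' : ∀ B, μ'.real B = a * μ.real B := fun B => by
    rw [measureReal_nnreal_smul_apply, Real.coe_toNNReal _ ha.le]
  have hnull : ∀ (p : Measure S.G) [IsFiniteMeasure p],
      (∀ w, w ≠ [] → p.real (S.subcell w) = a * μ.real (S.subcell w)) →
      ∀ w w' : List (Fin n), w.length = w'.length → w ≠ w' →
        p (S.subcell w ∩ S.subcell w') = 0 := by
    intro p _ hp w w' hl hne
    -- Distinct words of equal length require two letters, so the contraction θ is available exactly
    -- where it is used.
    have hn : Nontrivial (Fin n) := by
      by_contra hn
      rw [not_nontrivial_iff_subsingleton] at hn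
      exact hne (List.ext_getElem hl fun k _ _ => Subsingleton.elim _ _)
    obtain ⟨θ, hθ0, hθ1, hθ⟩ := hθ hn
    refine measure_finite_eq_zero (c := a * hs d Q T) hθ0 hθ1 (fun w hw => ?_)
      (hov.finite_subcell_inter hl hne)
    rw [hp w hw]
    exact (mul_le_mul_of_nonneg_left (hle θ hθ0 hθ w) ha.le).trans_eq (by ring)
  have : κ = μ' := by
    refine measure_eq_of_subcell (fun w hw => ?_) (hnull κ hκ) (hnull μ' fun w _ => hμ' _)
    rw [← measureReal_eq_measureReal_iff, hκ w hw, hμ']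
  rw [this, hμ']

end IFS

end Fractal

/-! ### Assembly. -/

namespace Fractal.IFS

variable {d n : ℕ} {S : IFS d n} {D : Fin n → Mat d} {β : ℝ} {Q : Mat d}
  {τ : NormedMeasure S.G (Mat d)}

theorem exists_contraction_const (hd : 0 < d) (hD : ∀ i x, jac (S.ψ i) x = D i) (hβ : 0 < β)
    (hQ : Q.PosDef) (hQe : transfer D Q = β • Q) (hn : Nontrivial (Fin n)) :
    ∃ θ : ℝ, 0 ≤ θ ∧ θ < 1 ∧ ∀ i v, quad Q (D i *ᵥ v) ≤ quad ((θ * β) • Q) v :=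
  exists_quad_mulVec_le hd (fun i _ => eq_zero_of_mulVec_eq_zero hD i) hn hβ hQ hQe

theorem IsSelfSimilar.exists_measure (h : S.IsSelfSimilar D β τ) (hd : 0 < d)
    (hD : ∀ i x, jac (S.ψ i) x = D i) (hov : S.FiniteOverlap) (hpcf : S.PostCriticallyFinite)
    (hβ : 0 < β) (hQ : Q.PosDef) (hQe : transfer D Q = β • Q) :
    ∃ μ : Measure S.G, IsFiniteMeasure μ ∧ (∀ B, MeasurableSet B → hs d Q (τ B) = μ.real B) ∧
      ∀ w, μ.real (S.subcell w) =
        (β ^ w.length)⁻¹ * hs d Q ((w.map D).prod * τ univ * ((w.map D).prod)ᵀ) := by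
  obtain ⟨μ, hμ, hμτ⟩ := exists_measure_hs h.posSemidef (posSemidef_iff_quad.1 hQ.posSemidef).2
  refine ⟨μ, hμ, hμτ, fun w => ?_⟩
  rw [← hμτ _ (S.isClosed_subcell w).measurableSet, h.apply_subcell hov hβ fun hn B hB => ?_,
    hs_smul_right]
  obtain ⟨θ, hθ0, hθ1, hθ⟩ := exists_contraction_const hd hD hβ hQ hQe hn
  exact h.eq_zero_of_finite hpcf hβ hQ hθ0 hθ1 hθ hB

/-- Nondegenerate systems with constant derivatives have a self-similar matrix measure. -/
theorem exists_isSelfSimilar_normalised (hd : 0 < d) (hD : ∀ i x, jac (S.ψ i) x = D i)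
    (hND : S.Nondegenerate) :
    ∃ (β : ℝ) (Q : Mat d) (τ : NormedMeasure S.G (Mat d)), 0 < β ∧ Q.PosDef ∧
      transfer D Q = β • Q ∧ S.IsSelfSimilar D β τ ∧ (τ univ).PosSemidef ∧ τ univ ≠ 0 ∧
      hs d Q (τ univ) = 1 := by
  have hI := irred_of_nondegenerate hND hD
  obtain ⟨β, Q, hβ, hQ, hQe⟩ := hI.exists_eigenvector hd
  obtain ⟨β', T, hβ', hT, hTe⟩ := hI.transpose.exists_eigenvector hd
  have hT0 : T ≠ 0 := by
    rintro rfl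
    have := (posDef_iff_quad.1 hT).2 (fun _ => 1) fun h0 => one_ne_zero (congrFun h0 ⟨0, hd⟩)
    simp [quad] at this
  obtain rfl := eigenvalue_eq_of_dual hQ hT.posSemidef hT0 hQe hTe
  have hpos := hs_pos hQ hT.posSemidef hT0
  obtain ⟨τ, hτ, hτT⟩ := exists_isSelfSimilar hd hD hβ hQ hQe
    (hT.posSemidef.smul (inv_nonneg.2 hpos.le)) (T := (hs d Q T)⁻¹ • T)
    (by rw [transfer_smul, hTe, smul_comm])
  refine ⟨β, Q, τ, hβ, hQ, hQe, hτ, hτ.posSemidef _ MeasurableSet.univ, ?_, ?_⟩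
  · rw [hτT]
    exact smul_ne_zero (inv_ne_zero hpos.ne') hT0
  · rw [hτT, hs_smul_right, inv_mul_cancel₀ hpos.ne']

theorem transfer_transpose (D : Fin n → Mat d) (T : Mat d) :
    transfer (fun i => (D i)ᵀ) T = ∑ i, D i * T * (D i)ᵀ := by
  simp only [transfer, Matrix.transpose_transpose]

end Fractal.IFS

theorem mainTheorem5 {d n : ℕ} (hd : 0 < d) (S : Fractal.IFS d n)
    (hF2 : S.FiniteOverlap) (hF3 : S.PostCriticallyFinite) (hF4 : S.OpenSeparation)
    (hND : S.Nondegenerate)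
    (D : Fin n → Fractal.Mat d) (hD : ∀ i x, Fractal.jac (S.ψ i) x = D i) :
    (∃ β Q τ, S.IsGibbs β Q τ) ∧
    (∃ κ : MeasureTheory.Measure S.G, S.IsKusuoka D κ) ∧
    ∀ β Q τ, S.IsGibbs β Q τ →
      (∃ Q₀ : Fractal.Mat d, (∀ x, Q x = Q₀) ∧ β • Q₀ = ∑ i, (D i)ᵀ * Q₀ * D i) ∧
      β • τ Set.univ = ∑ i, D i * τ Set.univ * (D i)ᵀ ∧
      ∀ κ : MeasureTheory.Measure S.G, S.IsKusuoka D κ →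
        ∃ c : ℝ, 0 < c ∧ ∀ B : Set S.G, MeasurableSet B → S.hsMeasure Q τ B = c * κ.real B := by
  have hI := Fractal.IFS.irred_of_nondegenerate hND hD
  refine ⟨?_, ?_, fun β Q τ h => ?_⟩
  · obtain ⟨β, Q, τ, hβ, hQ, hQe, hτ, -, -, h1⟩ :=
      Fractal.IFS.exists_isSelfSimilar_normalised hd hD hND
    exact ⟨β, _, τ, hτ.isGibbs hD hβ hQ hQe h1⟩
  · obtain ⟨β, Q, τ, hβ, hQ, hQe, hτ, hT, hT0, h1⟩ :=
      Fractal.IFS.exists_isSelfSimilar_normalised hd hD hND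
    obtain ⟨μ, hμ, -, hμw⟩ := hτ.exists_measure hd hD hF2 hF3 hβ hQ hQe
    have hTe := hτ.transfer_univ
    rw [Fractal.IFS.transfer_transpose] at hTe
    refine ⟨μ, hμ, β, Q, τ Set.univ, hβ, hQ.posSemidef, ?_, hT, hT0, hQe.symm, hTe.symm,
      fun w _ => hμw w⟩
    rintro rfl
    simp at h1
  · obtain ⟨x₀⟩ : Nonempty S.G := inferInstance
    obtain ⟨Q₀, rfl⟩ : ∃ Q₀ : Fractal.Mat d, Q = fun _ => Q₀ := ⟨Q x₀, funext fun x =>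
      Fractal.IFS.eigenfunction_eq hd hD h.pos h.continuous h.posDef h.eigen x x₀⟩
    have hβ := h.pos
    have hQ : Q₀.PosDef := h.posDef x₀
    have hQe : Fractal.transfer D Q₀ = β • Q₀ :=
      (Fractal.IFS.ruelle_const hD Q₀ x₀).symm.trans (h.eigen x₀)
    have hτ := h.isSelfSimilar hD
    have hTe := hτ.transfer_univ
    have hT := hτ.posSemidef _ MeasurableSet.univ
    refine ⟨⟨Q₀, fun _ => rfl, hQe.symm⟩, ?_, ?_⟩
    · rw [← Fractal.IFS.transfer_transpose, hTe]
    rintro κ ⟨hκ, β₁, Q₁, Q₁', hβ₁, hQ₁, hQ₁0, hQ₁', hQ₁'0, hQ₁e, hQ₁'e, hκw⟩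
    have hT0 : τ Set.univ ≠ 0 := by
      intro h0
      have h1 := h.normalised
      have hfin := Fractal.isFiniteMeasure_variation h.posSemidef
      rw [VectorMeasure.integral_const, h0] at h1
      simp at h1
    have hTp := hI.transpose.posDef_of_eigenvector hβ hT hT0 hTe
    rw [← Fractal.IFS.transfer_transpose] at hQ₁'e
    -- Pairing the Kusuoka eigenvector Q₁ with τ(G) identifies the eigenvalues; uniqueness then
    -- gives Q₁ = a Q₀ and Q₁' = a' τ(G), so the cell masses differ by the factor a a'.
    obtain rfl : β₁ = β := Fractal.eigenvalue_eq_of_dual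
      (hI.posDef_of_eigenvector hβ₁ hQ₁ hQ₁0 hQ₁e.symm) hT hT0 hQ₁e.symm hTe
    obtain ⟨a, ha, rfl⟩ := hI.eigenvector_unique hd hQ hQe hQ₁ hQ₁0 hQ₁e.symm
    obtain ⟨a', ha', rfl⟩ := hI.transpose.eigenvector_unique hd hTp hTe hQ₁' hQ₁'0 hQ₁'e.symm
    obtain ⟨μ, hμ, hμτ, hμw⟩ := hτ.exists_measure hd hD hF2 hF3 hβ hQ hQe
    have haa := mul_pos ha ha'
    refine ⟨(a * a')⁻¹, inv_pos.2 haa, fun B hB => ?_⟩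
    have hκμ : κ.real B = a * a' * μ.real B := by
      refine Fractal.IFS.measureReal_eq_mul_of_subcell hF2 hT hβ haa
        (Fractal.IFS.exists_contraction_const hd hD hβ hQ hQe) hμw (fun w hw => ?_) B
      rw [hμw, show κ.real (S.subcell w) = _ from hκw w hw, Fractal.hs_smul_left, Matrix.mul_smul,
        Matrix.smul_mul, Fractal.hs_smul_right]
      ring
    rw [Fractal.IFS.hsMeasure_const h.posSemidef, hμτ B hB, hκμ, inv_mul_cancel_left₀ haa.ne']
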